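/- **Setting.** Let $\Omega\subset\mathbb R^2$ be a bounded polygonal domain (not necessarily convex) with boundary $\Gamma$, let $\Omega_h$ be a finite decomposition of $\Omega$ into non-overlapping simple polygons $K$ (hanging nodes count as vertices, so each edge lies on $\Gamma$ or is shared by two elements), and let $k\ge 2$. Fix one of the boundary conditions CP (clamped), NC (Navier), CH (Cahn–Hilliard). Let $\alpha_1,\alpha_2>0$ and let $f:\mathbb R\to\mathbb R$ satisfy $|f(x)-f(y)|\le L_f|x-y|$ for all $x,y$, with $L_f>0$. For $\ell\ge0$, $\mathbb P_\ell$ denotes polynomials of degree at most $\ell$, and $\mathbb P_{-1}=\{0\}$. *Space.* $H^{2,\mathrm{nc}}_k(\Omega_h)$ is the set of $v\in L^2(\Omega)$ with $v|_K\in H^2(K)$ for all $K$ such that: $v$ is continuous at the interior vertices and zero at the boundary vertices (for CH: continuous at all vertices); $([\![v]\!],p)_{0,e}=0$ for all $p\in\mathbb P_{k-3}(e)$ and all edges $e$ (for CH: all interior edges); and $([\![\partial_{n_e}v]\!],q)_{0,e}=0$ for all $q\in\mathbb P_{k-2}(e)$ and all edges $e$. On a boundary edge, the jump of a function is its trace.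 For each $K$ let $V_k^h(K)$ be a finite-dimensional space with $\mathbb P_k(K)\subseteq V_k^h(K)\subseteq H^2(K)$, and let $V_k^h:=\{v\in H^{2,\mathrm{nc}}_k(\Omega_h): v|_K\in V_k^h(K)\ \forall K\in\Omega_h\}$. *Forms.* Put $M^K(v,w)=(v,w)_K$, $B^K(v,w)=(\nabla v,\nabla w)_K$, $A^K(v,w)=(\nabla^2v,\nabla^2w)_K$ and $P_0(v)=(v,1)_{\partial K}$. Let $\Pi^\ell_K$ be the $L^2(K)$-orthogonal projection onto $\mathbb P_\ell(K)$ (applied componentwise to vector fields). Let $\Pi_K^{k,\nabla}v\in\mathbb P_k(K)$ be given by $B^K(v-\Pi_K^{k,\nabla}v,q)=0$ for all $q\in\mathbb P_k(K)$ and $P_0(v-\Pi_K^{k,\nabla}v)=0$, and let $\Pi_K^{k,\nabla^2}v\in\mathbb P_k(K)$ be given by $A^K(v-\Pi_K^{k,\nabla^2}v,q)=0$ for all $q\in\mathbb P_k(K)$, $P_0(v-\Pi_K^{k,\nabla^2}v)=0$ and $P_0(\nabla(v-\Pi_K^{k,\nabla^2}v))=0$. Let $S_0^K,S_\nabla^K,S_{\nabla^2}^K$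 be symmetric positive definite bilinear forms on $V_k^h(K)$ that are equivalent, with positive constants independent of $K$, to $M^K$ on $\ker\Pi^k_K$, to $B^K$ on $\ker\Pi_K^{k,\nabla}$ and to $A^K$ on $\ker\Pi_K^{k,\nabla^2}$, respectively. Define $$\begin{aligned} M_h(v,w)&=\sum_K (\Pi^k_Kv,\Pi^k_Kw)_{K}+S_0^K((I-\Pi^k_K)v,(I-\Pi^k_K)w),\\ A_h(v,w)&=\sum_K A^K(\Pi^{k,\nabla^2}_Kv,\Pi^{k,\nabla^2}_Kw)+S_{\nabla^2}^K((I-\Pi^{k,\nabla^2}_K)v,(I-\Pi^{k,\nabla^2}_K)w),\\ B_h(v,w)&=\sum_K (\Pi^{k-1}_K\nabla v,\Pi^{k-1}_K\nabla w)_{K}+S_{\nabla}^K((I-\Pi^{k,\nabla}_K)v,(I-\Pi^{k,\nabla}_K)w),\\ F_h(v;w)&=\sum_K (\Pi^k_Kf(\Pi^k_Kv),w)_{K}. \end{aligned}$$ **Theorem.** There are constants $C_{M,*},C_M^*>0$ such that, for all $v,w\in V_k^h$, $$|M_h(v,w)|\le C_M^*\|v\|_{0,\Omega}\|w\|_{0,\Omega},\qquad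 M_h(v,v)\ge C_{M,*}\|v\|_{0,\Omega}^2. \tag{1}$$ Let $C_{M,*},C_M^*>0$ be any constants for which (1) holds and put $\widehat M:=\max\{C_{M,*},(C_M^*)^2C_{M,*}^{-1}\}$. Let $T>0$, let $N\ge1$ be an integer and let $\Delta t=T/N$. If $$\Delta t<(2L_f)^{-1}\min\{\widehat M,C_{M,*}\},$$ then for every $1\le n\le N$ and all given $u_h^0,\dots,u_h^{n-1}\in V_k^h$ there is a unique $u_h^n\in V_k^h$ such that $$M_h\Big(\frac{u_h^n-u_h^{n-1}}{\Delta t},v_h\Big)+\alpha_1A_h(u_h^n,v_h)+\alpha_2B_h(u_h^n,v_h)=F_h(u_h^n;v_h)\qquad\forall v_h\in V_k^h .$$ -/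

import Mathlib

open MeasureTheory Set Filter Topology
open scoped ContDiff RealInnerProductSpace

noncomputable section

namespace NCVEM

/-! ### Sobolev spaces on open subsets of the plane -/

/-- The Euclidean plane. -/
abbrev Plane : Type := EuclideanSpace ℝ (Fin 2)

/-- The Hilbert space `L²(D)` of classes of square integrable functions on `D`. -/
abbrev L2 (D : Set Plane) : Type := Lp ℝ 2 (volume.restrict D)

/-- Classical partial derivative in the direction of the `i`-th coordinate. -/
def pderiv (i : Fin 2) (φ : Plane → ℝ) (x : Plane) : ℝ :=
  fderiv ℝ φ x (EuclideanSpace.single i 1)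

/-- `g` is the weak `i`-th partial derivative of `u` on `D`. -/
def HasWeakDeriv (D : Set Plane) (i : Fin 2) (u g : L2 D) : Prop :=
  ∀ φ : Plane → ℝ, ContDiff ℝ ∞ φ → HasCompactSupport φ → tsupport φ ⊆ D →
    ∫ x in D, u x * pderiv i φ x = - ∫ x in D, g x * φ x

theorem integrable_mul_test {D : Set Plane} (u : L2 D) {φ : Plane → ℝ}
    (hφ : Continuous φ) (hc : HasCompactSupport φ) :
    Integrable (fun x => u x * φ x) (volume.restrict D) := by
  have h1 : MemLp (fun x => u x) 2 (volume.restrict D) := Lp.memLp u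
  have h2 : MemLp φ 2 (volume.restrict D) :=
    (hφ.memLp_of_hasCompactSupport hc).restrict D
  exact h1.integrable_mul h2

theorem pderiv_continuous (i : Fin 2) {φ : Plane → ℝ} (hφ : ContDiff ℝ ∞ φ) :
    Continuous (pderiv i φ) :=
  (hφ.continuous_fderiv (by simp)).clm_apply continuous_const

theorem pderiv_hasCompactSupport (i : Fin 2) {φ : Plane → ℝ} (hc : HasCompactSupport φ) :
    HasCompactSupport (pderiv i φ) :=
  hc.fderiv_apply (𝕜 := ℝ) _

theorem HasWeakDeriv.add {D : Set Plane} {i : Fin 2} {u v g h : L2 D}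
    (hu : HasWeakDeriv D i u g) (hv : HasWeakDeriv D i v h) :
    HasWeakDeriv D i (u + v) (g + h) := by
  intro φ hφ hc hs
  have e1 : ∫ x in D, (u + v : L2 D) x * pderiv i φ x
      = ∫ x in D, (u x * pderiv i φ x + v x * pderiv i φ x) := by
    refine integral_congr_ae ?_
    filter_upwards [Lp.coeFn_add u v] with x hx
    rw [hx, Pi.add_apply, add_mul]
  have e2 : ∫ x in D, (g + h : L2 D) x * φ x
      = ∫ x in D, (g x * φ x + h x * φ x) := by
    refine integral_congr_ae ?_
    filter_upwards [Lp.coeFn_add g h] with x hx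
    rw [hx, Pi.add_apply, add_mul]
  have hp := pderiv_continuous i hφ
  have hpc := pderiv_hasCompactSupport i hc
  rw [e1, e2, integral_add (integrable_mul_test u hp hpc) (integrable_mul_test v hp hpc),
    integral_add (integrable_mul_test g hφ.continuous hc)
      (integrable_mul_test h hφ.continuous hc), hu φ hφ hc hs, hv φ hφ hc hs]
  ring

theorem HasWeakDeriv.smul {D : Set Plane} {i : Fin 2} {u g : L2 D} (a : ℝ)
    (hu : HasWeakDeriv D i u g) : HasWeakDeriv D i (a • u) (a • g) := by
  intro φ hφ hc hs
  have e1 : ∫ x in D, (a • u : L2 D) x * pderiv i φ x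
      = ∫ x in D, a * (u x * pderiv i φ x) := by
    refine integral_congr_ae ?_
    filter_upwards [Lp.coeFn_smul a u] with x hx
    rw [hx, Pi.smul_apply, smul_eq_mul, mul_assoc]
  have e2 : ∫ x in D, (a • g : L2 D) x * φ x = ∫ x in D, a * (g x * φ x) := by
    refine integral_congr_ae ?_
    filter_upwards [Lp.coeFn_smul a g] with x hx
    rw [hx, Pi.smul_apply, smul_eq_mul, mul_assoc]
  rw [e1, e2, integral_const_mul, integral_const_mul, hu φ hφ hc hs]
  ring

theorem HasWeakDeriv.zero (D : Set Plane) (i : Fin 2) :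
    HasWeakDeriv D i (0 : L2 D) (0 : L2 D) := by
  have key : ∀ ψ : Plane → ℝ, ∫ x in D, (0 : L2 D) x * ψ x = 0 := by
    intro ψ
    rw [integral_congr_ae (g := fun _ => (0 : ℝ))]
    · simp
    · filter_upwards [Lp.coeFn_zero ℝ 2 (volume.restrict D)] with x hx
      rw [hx]
      simp
  intro φ _ _ _
  rw [key, key, neg_zero]

theorem HasWeakDeriv.unique {D : Set Plane} (hD : IsOpen D) {i : Fin 2} {u g h : L2 D}
    (hg : HasWeakDeriv D i u g) (hh : HasWeakDeriv D i u h) : g = h := by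
  have hloc : ∀ w : L2 D, LocallyIntegrableOn (fun x => w x) D volume := by
    intro w
    rw [locallyIntegrableOn_iff hD.isLocallyClosed]
    intro C hCD hC
    have h1 : MemLp (fun x => w x) 2 (volume.restrict C) :=
      (Lp.memLp w).mono_measure (Measure.restrict_mono_set _ hCD)
    have : IsFiniteMeasure (volume.restrict C) :=
      ⟨by simpa using hC.measure_lt_top⟩
    exact h1.integrable (by norm_num)
  have hae : ∀ᵐ x, x ∈ D → g x - h x = 0 := by
    refine hD.ae_eq_zero_of_integral_contDiff_smul_eq_zero ((hloc g).sub (hloc h)) ?_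
    intro φ hφ hc hs
    have e := (hg φ hφ hc hs).symm.trans (hh φ hφ hc hs)
    have hsupp : Function.support (fun x => φ x • (g x - h x)) ⊆ D := by
      intro x hx
      apply hs
      apply subset_tsupport
      intro h0
      exact hx (by simp [h0])
    rw [← setIntegral_eq_integral_of_forall_compl_eq_zero (s := D)
      (fun x hx => by by_contra h0; exact hx (hsupp h0))]
    have e3 : ∫ x in D, φ x • (g x - h x)
        = ∫ x in D, (g x * φ x - h x * φ x) := by
      refine integral_congr_ae (Eventually.of_forall fun x => ?_)
      simp only [smul_eq_mul]
      ring
    rw [e3, integral_sub (integrable_mul_test g hφ.continuous hc)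
      (integrable_mul_test h hφ.continuous hc)]
    linarith
  refine Lp.ext ?_
  rw [EventuallyEq, ae_restrict_iff' hD.measurableSet]
  filter_upwards [hae] with x hx hxD
  linarith [hx hxD]

/-- `H¹(D)`: all first weak partial derivatives exist in `L²(D)`. -/
def H1 (D : Set Plane) : Submodule ℝ (L2 D) where
  carrier := {u | ∀ i, ∃ g : L2 D, HasWeakDeriv D i u g}
  add_mem' := fun hu hv i => by
    obtain ⟨g, hg⟩ := hu i
    obtain ⟨h, hh⟩ := hv i
    exact ⟨g + h, hg.add hh⟩
  zero_mem' := fun i => ⟨0, HasWeakDeriv.zero D i⟩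
  smul_mem' := fun a u hu i => by
    obtain ⟨g, hg⟩ := hu i
    exact ⟨a • g, hg.smul a⟩

/-- `H²(D)`: all first weak partial derivatives exist and lie in `H¹(D)`. -/
def H2 (D : Set Plane) : Submodule ℝ (L2 D) where
  carrier := {u | ∀ i, ∃ g ∈ H1 D, HasWeakDeriv D i u g}
  add_mem' := fun hu hv i => by
    obtain ⟨g, hg1, hg⟩ := hu i
    obtain ⟨h, hh1, hh⟩ := hv i
    exact ⟨g + h, add_mem hg1 hh1, hg.add hh⟩
  zero_mem' := fun i => ⟨0, zero_mem _, HasWeakDeriv.zero D i⟩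
  smul_mem' := fun a u hu i => by
    obtain ⟨g, hg1, hg⟩ := hu i
    exact ⟨a • g, Submodule.smul_mem _ a hg1, hg.smul a⟩

open Classical in
/-- The weak partial derivative `∂ᵢ u` of `u ∈ H¹(D)` (zero if it does not exist). -/
def weakDeriv (D : Set Plane) (i : Fin 2) (u : L2 D) : L2 D :=
  if h : ∃ g : L2 D, HasWeakDeriv D i u g then h.choose else 0

theorem HasWeakDeriv.weakDeriv_eq {D : Set Plane} (hD : IsOpen D) {i : Fin 2} {u g : L2 D}
    (hg : HasWeakDeriv D i u g) : weakDeriv D i u = g := by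
  have h : ∃ g : L2 D, HasWeakDeriv D i u g := ⟨g, hg⟩
  rw [weakDeriv, dif_pos h]
  exact h.choose_spec.unique hD hg

theorem H2_le_H1 (D : Set Plane) : H2 D ≤ H1 D := by
  intro u hu i
  obtain ⟨g, _, hg⟩ := hu i
  exact ⟨g, hg⟩

theorem hasWeakDeriv_weakDeriv {D : Set Plane} {u : L2 D} (hu : u ∈ H1 D) (i : Fin 2) :
    HasWeakDeriv D i u (weakDeriv D i u) := by
  rw [weakDeriv, dif_pos (hu i)]
  exact (hu i).choose_spec

/-- Restriction of square integrable functions to a smaller set. -/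
def restrictL {D Ω : Set Plane} (h : D ⊆ Ω) : L2 Ω →ₗ[ℝ] L2 D where
  toFun v := ((Lp.memLp v).mono_measure (Measure.restrict_mono_set volume h)).toLp v
  map_add' := fun u v => by
    refine Lp.ext ?_
    have hae := ae_mono (Measure.restrict_mono_set volume h) (Lp.coeFn_add u v)
    filter_upwards [hae, MemLp.coeFn_toLp ((Lp.memLp (u + v)).mono_measure
        (Measure.restrict_mono_set volume h)),
      MemLp.coeFn_toLp ((Lp.memLp u).mono_measure (Measure.restrict_mono_set volume h)),
      MemLp.coeFn_toLp ((Lp.memLp v).mono_measure (Measure.restrict_mono_set volume h)),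
      Lp.coeFn_add
        (((Lp.memLp u).mono_measure (Measure.restrict_mono_set volume h)).toLp u)
        (((Lp.memLp v).mono_measure (Measure.restrict_mono_set volume h)).toLp v)]
      with x h0 h1 h2 h3 h4
    rw [h1, h4, Pi.add_apply, h2, h3, h0, Pi.add_apply]
  map_smul' := fun a v => by
    refine Lp.ext ?_
    have hae := ae_mono (Measure.restrict_mono_set volume h) (Lp.coeFn_smul a v)
    filter_upwards [hae, MemLp.coeFn_toLp ((Lp.memLp (a • v)).mono_measure
        (Measure.restrict_mono_set volume h)),
      MemLp.coeFn_toLp ((Lp.memLp v).mono_measure (Measure.restrict_mono_set volume h)),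
      Lp.coeFn_smul a
        (((Lp.memLp v).mono_measure (Measure.restrict_mono_set volume h)).toLp v)]
      with x h0 h1 h2 h3
    simp only [RingHom.id_apply]
    rw [h1, h3, Pi.smul_apply, h2, h0, Pi.smul_apply]

open Classical in
/-- The class in `L²(D)` of a square integrable function (zero for other functions). -/
def toL2 (D : Set Plane) (g : Plane → ℝ) : L2 D :=
  if h : MemLp g 2 (volume.restrict D) then h.toLp g else 0

/-- `γ` is the trace on the segment from `a` to `b` of `w ∈ H¹(D)`: some functions smooth on the
whole plane converge to `w` in `H¹(D)` and to `γ` in `L²` of the segment. -/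
def HasTrace (D : Set Plane) (a b : Plane) (w : L2 D) (γ : Plane → ℝ) : Prop :=
  w ∈ H1 D ∧
  MemLp (fun t : ℝ => γ (AffineMap.lineMap a b t)) 2 (volume.restrict (Icc 0 1)) ∧
  ∃ φ : ℕ → Plane → ℝ, (∀ m, ContDiff ℝ ∞ (φ m)) ∧
    Tendsto (fun m => eLpNorm (fun x => φ m x - w x) 2 (volume.restrict D)) atTop (𝓝 0) ∧
    (∀ i, Tendsto (fun m => eLpNorm (fun x => pderiv i (φ m) x - weakDeriv D i w x) 2
      (volume.restrict D)) atTop (𝓝 0)) ∧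
    Tendsto (fun m => eLpNorm (fun t : ℝ =>
        φ m (AffineMap.lineMap a b t) - γ (AffineMap.lineMap a b t)) 2
      (volume.restrict (Icc 0 1))) atTop (𝓝 0)

theorem tendsto_eLpNorm_comb {α : Type*} [MeasurableSpace α] {μ : Measure α}
    {F G H : ℕ → α → ℝ} (a b : ℝ) (hF : ∀ m, AEStronglyMeasurable (F m) μ)
    (hG : ∀ m, AEStronglyMeasurable (G m) μ)
    (tF : Tendsto (fun m => eLpNorm (F m) 2 μ) atTop (𝓝 0))
    (tG : Tendsto (fun m => eLpNorm (G m) 2 μ) atTop (𝓝 0))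
    (hH : ∀ m, H m =ᵐ[μ] a • F m + b • G m) :
    Tendsto (fun m => eLpNorm (H m) 2 μ) atTop (𝓝 0) := by
  have t : Tendsto (fun m => ‖a‖ₑ * eLpNorm (F m) 2 μ + ‖b‖ₑ * eLpNorm (G m) 2 μ)
      atTop (𝓝 0) := by
    have t1 := ENNReal.Tendsto.const_mul (a := ‖a‖ₑ) tF (Or.inr enorm_ne_top)
    have t2 := ENNReal.Tendsto.const_mul (a := ‖b‖ₑ) tG (Or.inr enorm_ne_top)
    simpa using t1.add t2
  refine tendsto_of_tendsto_of_tendsto_of_le_of_le tendsto_const_nhds t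
    (fun _ => zero_le) (fun m => ?_)
  show eLpNorm (H m) 2 μ ≤ _
  rw [eLpNorm_congr_ae (hH m)]
  refine (eLpNorm_add_le ((hF m).const_smul a) ((hG m).const_smul b) (by norm_num)).trans ?_
  rw [eLpNorm_const_smul, eLpNorm_const_smul]

theorem coeFn_comb {D : Set Plane} (a b : ℝ) (u v : L2 D) :
    ∀ᵐ x ∂(volume.restrict D), (a • u + b • v : L2 D) x = a * u x + b * v x := by
  filter_upwards [Lp.coeFn_add (a • u) (b • v), Lp.coeFn_smul a u, Lp.coeFn_smul b v]
    with x h1 h2 h3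
  rw [h1, Pi.add_apply, h2, h3, Pi.smul_apply, Pi.smul_apply, smul_eq_mul, smul_eq_mul]

theorem weakDeriv_comb {D : Set Plane} (hD : IsOpen D) (i : Fin 2) (a b : ℝ) {u v : L2 D}
    (hu : u ∈ H1 D) (hv : v ∈ H1 D) :
    weakDeriv D i (a • u + b • v) = a • weakDeriv D i u + b • weakDeriv D i v :=
  (((hasWeakDeriv_weakDeriv hu i).smul a).add
    ((hasWeakDeriv_weakDeriv hv i).smul b)).weakDeriv_eq hD

theorem HasTrace.comb {D : Set Plane} (hD : IsOpen D) {p q : Plane} (a b : ℝ) {u v : L2 D}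
    {γ δ : Plane → ℝ} (hu : HasTrace D p q u γ) (hv : HasTrace D p q v δ) :
    HasTrace D p q (a • u + b • v) (fun x => a * γ x + b * δ x) := by
  obtain ⟨u1, gm, φ, φs, φ0, φ1, φt⟩ := hu
  obtain ⟨v1, dm, ψ, ψs, ψ0, ψ1, ψt⟩ := hv
  have hline : Continuous (fun t : ℝ => (AffineMap.lineMap p q t : Plane)) :=
    AffineMap.lineMap_continuous
  refine ⟨add_mem (Submodule.smul_mem _ a u1) (Submodule.smul_mem _ b v1),
    (gm.const_mul a).add (dm.const_mul b), fun m x => a * φ m x + b * ψ m x,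
    fun m => (contDiff_const.mul (φs m)).add (contDiff_const.mul (ψs m)), ?_, ?_, ?_⟩
  · refine tendsto_eLpNorm_comb a b
      (fun m => (φs m).continuous.aestronglyMeasurable.sub (Lp.aestronglyMeasurable u))
      (fun m => (ψs m).continuous.aestronglyMeasurable.sub (Lp.aestronglyMeasurable v))
      φ0 ψ0 (fun m => ?_)
    filter_upwards [coeFn_comb a b u v] with x hx
    simp only [hx, Pi.add_apply, Pi.smul_apply, smul_eq_mul, Pi.sub_apply]
    ring
  · intro i
    refine tendsto_eLpNorm_comb a b
      (fun m => (pderiv_continuous i (φs m)).aestronglyMeasurable.sub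
        (Lp.aestronglyMeasurable _))
      (fun m => (pderiv_continuous i (ψs m)).aestronglyMeasurable.sub
        (Lp.aestronglyMeasurable _))
      (φ1 i) (ψ1 i) (fun m => ?_)
    rw [weakDeriv_comb hD i a b u1 v1]
    filter_upwards [coeFn_comb a b (weakDeriv D i u) (weakDeriv D i v)] with x hx
    have dφ : DifferentiableAt ℝ (φ m) x := ((φs m).differentiable (by simp)).differentiableAt
    have dψ : DifferentiableAt ℝ (ψ m) x := ((ψs m).differentiable (by simp)).differentiableAt
    have e : pderiv i (fun x => a * φ m x + b * ψ m x) x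
        = a * pderiv i (φ m) x + b * pderiv i (ψ m) x := by
      unfold pderiv
      rw [fderiv_fun_add (dφ.const_mul a) (dψ.const_mul b), fderiv_const_mul dφ,
        fderiv_const_mul dψ]
      simp
    simp only [hx, e, Pi.add_apply, Pi.smul_apply, smul_eq_mul, Pi.sub_apply]
    ring
  · refine tendsto_eLpNorm_comb a b
      (fun m => ((φs m).continuous.comp hline).aestronglyMeasurable.sub gm.1)
      (fun m => ((ψs m).continuous.comp hline).aestronglyMeasurable.sub dm.1)
      φt ψt (fun m => Eventually.of_forall fun t => ?_)
    simp only [Pi.add_apply, Pi.smul_apply, smul_eq_mul, Pi.sub_apply, Function.comp]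
    ring

theorem HasTrace.zero {D : Set Plane} (hD : IsOpen D) (p q : Plane) :
    HasTrace D p q (0 : L2 D) (fun _ => 0) := by
  refine ⟨zero_mem _, MemLp.zero', fun _ _ => 0, fun _ => contDiff_const, ?_, ?_, ?_⟩
  · have : ∀ m : ℕ, eLpNorm (fun x => (0 : ℝ) - (0 : L2 D) x) 2 (volume.restrict D) = 0 := by
      intro m
      rw [eLpNorm_congr_ae (g := fun _ => (0 : ℝ))]
      · simp
      · filter_upwards [Lp.coeFn_zero ℝ 2 (volume.restrict D)] with x hx
        rw [hx]
        simp
    simp only [this 0]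
    exact tendsto_const_nhds
  · intro i
    rw [(HasWeakDeriv.zero D i).weakDeriv_eq hD]
    have : eLpNorm (fun x => pderiv i (fun _ => (0 : ℝ)) x - (0 : L2 D) x) 2
        (volume.restrict D) = 0 := by
      rw [eLpNorm_congr_ae (g := fun _ => (0 : ℝ))]
      · simp
      · filter_upwards [Lp.coeFn_zero ℝ 2 (volume.restrict D)] with x hx
        rw [hx]
        simp [pderiv]
    simp only [this]
    exact tendsto_const_nhds
  · simp

/-- `c` is the representative of `w` that is continuous up to the boundary of `D`. -/
def HasContRep (D : Set Plane) (w : L2 D) (c : Plane → ℝ) : Prop :=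
  ContinuousOn c (closure D) ∧ ∀ᵐ x ∂(volume.restrict D), w x = c x

theorem HasContRep.comb {D : Set Plane} (a b : ℝ) {u v : L2 D} {c d : Plane → ℝ}
    (hu : HasContRep D u c) (hv : HasContRep D v d) :
    HasContRep D (a • u + b • v) (fun x => a * c x + b * d x) := by
  refine ⟨(hu.1.const_smul a).add (hv.1.const_smul b), ?_⟩
  filter_upwards [coeFn_comb a b u v, hu.2, hv.2] with x h1 h2 h3
  rw [h1, h2, h3]

theorem HasContRep.zero (D : Set Plane) : HasContRep D (0 : L2 D) (fun _ => 0) := by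
  refine ⟨continuousOn_const, ?_⟩
  filter_upwards [Lp.coeFn_zero ℝ 2 (volume.restrict D)] with x hx
  rw [hx]
  rfl

/-! ### Polygons and polygonal meshes -/

/-- A simple polygon: a closed broken line that does not intersect itself, with the bounded open
region that it encloses. -/
structure SimplePolygon where
  n : ℕ
  three_le : 3 ≤ n
  poly : Polygon Plane n
  simple : ∀ i j : Fin n, ∀ s ∈ Ico (0 : ℝ) 1, ∀ t ∈ Ico (0 : ℝ) 1,
    poly.edgePath ℝ i s = poly.edgePath ℝ j t → i = j ∧ s = t
  region : Set Plane
  isOpen_region : IsOpen region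
  nonempty_region : region.Nonempty
  isBounded_region : Bornology.IsBounded region
  frontier_region : frontier region = poly.boundary ℝ

namespace SimplePolygon

/-- The length of the `i`-th edge. -/
def edgeLength (P : SimplePolygon) (i : Fin P.n) : ℝ :=
  dist (P.poly i) (P.poly (finRotate P.n i))

/-- `∫_e g p ds` over the `i`-th edge, where `p` is a polynomial in the affine parameter of the
edge. -/
def edgeMoment (P : SimplePolygon) (i : Fin P.n) (g : Plane → ℝ) (p : Polynomial ℝ) : ℝ :=
  P.edgeLength i * ∫ t in (0 : ℝ)..1, g (P.poly.edgePath ℝ i t) * p.eval t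

/-- `∫_{∂K} g ds`. -/
def bdryIntegral (P : SimplePolygon) (g : Plane → ℝ) : ℝ :=
  ∑ i, P.edgeMoment i g 1

/-- A unit normal vector of the `i`-th edge. -/
def edgeNormal (P : SimplePolygon) (i : Fin P.n) : Fin 2 → ℝ :=
  ![(P.poly (finRotate P.n i) 1 - P.poly i 1) / P.edgeLength i,
    (P.poly i 0 - P.poly (finRotate P.n i) 0) / P.edgeLength i]

/-- `γ` is the trace of `w` on every edge of the polygon. -/
def HasBdryTrace (P : SimplePolygon) (w : L2 P.region) (γ : Plane → ℝ) : Prop :=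
  ∀ i : Fin P.n, HasTrace P.region (P.poly i) (P.poly (finRotate P.n i)) w γ

theorem memLp_poly (P : SimplePolygon) (p : MvPolynomial (Fin 2) ℝ) :
    MemLp (fun x : Plane => MvPolynomial.eval (fun i => x i) p) 2
      (volume.restrict P.region) := by
  have hcont : Continuous (fun x : Plane => MvPolynomial.eval (fun i => x i) p) :=
    (MvPolynomial.continuous_eval p).comp (continuous_pi fun i => by fun_prop)
  have hcomp : IsCompact (closure P.region) := P.isBounded_region.isCompact_closure
  obtain ⟨C, hC⟩ := hcomp.exists_bound_of_continuousOn hcont.continuousOn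
  have : IsFiniteMeasure (volume.restrict P.region) :=
    ⟨by simpa using P.isBounded_region.measure_lt_top⟩
  refine MemLp.of_bound hcont.aestronglyMeasurable C ?_
  exact (ae_restrict_mem P.isOpen_region.measurableSet).mono
    fun x hx => hC x (subset_closure hx)

/-- The class in `L²(K)` of a polynomial. -/
def polyClass (P : SimplePolygon) : MvPolynomial (Fin 2) ℝ →ₗ[ℝ] L2 P.region where
  toFun p := (P.memLp_poly p).toLp _
  map_add' := fun p q => by
    rw [← MemLp.toLp_add]
    congr 1
    funext x
    simp
  map_smul' := fun a p => by
    simp only [RingHom.id_apply]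
    rw [← MemLp.toLp_const_smul]
    congr 1
    funext x
    simp [MvPolynomial.smul_eval]

/-- `ℙ_ℓ(K)`, the polynomials of total degree at most `ℓ`, as a subspace of `L²(K)`. -/
def polySpace (P : SimplePolygon) (ℓ : ℕ) : Submodule ℝ (L2 P.region) :=
  (MvPolynomial.restrictTotalDegree (Fin 2) ℝ ℓ).map P.polyClass

instance (P : SimplePolygon) (ℓ : ℕ) : FiniteDimensional ℝ (P.polySpace ℓ) := by
  unfold polySpace
  infer_instance

/-! ### Local forms and polynomial projections -/

/-- `M^K(v, w) = (v, w)_K`. -/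
def formM (P : SimplePolygon) (v w : L2 P.region) : ℝ := ∫ x in P.region, v x * w x

/-- `B^K(v, w) = (∇v, ∇w)_K`. -/
def formB (P : SimplePolygon) (v w : L2 P.region) : ℝ :=
  ∑ i, P.formM (weakDeriv P.region i v) (weakDeriv P.region i w)

/-- `A^K(v, w) = (∇²v, ∇²w)_K`. -/
def formA (P : SimplePolygon) (v w : L2 P.region) : ℝ :=
  ∑ i, P.formB (weakDeriv P.region i v) (weakDeriv P.region i w)

/-- The `L²(K)`-orthogonal projection onto `ℙ_ℓ(K)`. -/
def projL2 (P : SimplePolygon) (ℓ : ℕ) (v : L2 P.region) : P.polySpace ℓ :=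
  (P.polySpace ℓ).orthogonalProjectionOnto v

open Classical in
/-- `P₀(v) = (v, 1)_{∂K}`, for `v` with a representative continuous up to the boundary (every
element of `H²(K)` has one, in two dimensions). -/
def meanVal (P : SimplePolygon) (v : L2 P.region) : ℝ :=
  if h : ∃ c, HasContRep P.region v c then P.bdryIntegral h.choose else 0

open Classical in
/-- `P₀(w) = (w, 1)_{∂K}`, for `w` with an `L²` trace on the boundary (every element of `H¹(K)` has
one); it is applied to the components of a gradient. -/
def meanTrace (P : SimplePolygon) (w : L2 P.region) : ℝ :=
  if h : ∃ γ, P.HasBdryTrace w γ then P.bdryIntegral h.choose else 0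

/-- The equations that define the `H¹`-seminorm projection `p ∈ ℙ_k(K)` of `v`. -/
def IsProjGrad (P : SimplePolygon) (k : ℕ) (v : L2 P.region) (p : P.polySpace k) : Prop :=
  (∀ q ∈ P.polySpace k, P.formB (v - p) q = 0) ∧ P.meanVal (v - p) = 0

/-- The equations that define the `H²`-seminorm projection `p ∈ ℙ_k(K)` of `v`. -/
def IsProjHess (P : SimplePolygon) (k : ℕ) (v : L2 P.region) (p : P.polySpace k) : Prop :=
  (∀ q ∈ P.polySpace k, P.formA (v - p) q = 0) ∧ P.meanVal (v - p) = 0 ∧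
    ∀ i, P.meanTrace (weakDeriv P.region i (v - p)) = 0

open Classical in
/-- The `H¹`-seminorm projection onto `ℙ_k(K)`. -/
def projGrad (P : SimplePolygon) (k : ℕ) (v : L2 P.region) : P.polySpace k :=
  if h : ∃ p, P.IsProjGrad k v p then h.choose else 0

open Classical in
/-- The `H²`-seminorm projection onto `ℙ_k(K)`. -/
def projHess (P : SimplePolygon) (k : ℕ) (v : L2 P.region) : P.polySpace k :=
  if h : ∃ p, P.IsProjHess k v p then h.choose else 0

end SimplePolygon

/-- The `i`-th edge of `P` and the `j`-th edge of `Q` have the same end points. -/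
def SameEdge (P : SimplePolygon) (i : Fin P.n) (Q : SimplePolygon) (j : Fin Q.n) : Prop :=
  (P.poly i = Q.poly j ∧ P.poly (finRotate P.n i) = Q.poly (finRotate Q.n j)) ∨
  (P.poly i = Q.poly (finRotate Q.n j) ∧ P.poly (finRotate P.n i) = Q.poly j)

/-- A (bounded) polygonal domain of the plane, not necessarily convex. -/
structure IsPolygonalDomain (Ω : Set Plane) : Prop where
  isOpen : IsOpen Ω
  isConnected : IsConnected Ω
  isBounded : Bornology.IsBounded Ω
  regular : interior (closure Ω) = Ω
  frontier_eq : ∃ S : Finset (Plane × Plane), frontier Ω = ⋃ s ∈ S, segment ℝ s.1 s.2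

/-- A decomposition of `Ω` into non-overlapping simple polygons. Hanging nodes count as vertices,
so that every edge lies on the boundary of `Ω` or is an edge of another element. -/
structure PolyMesh (Ω : Set Plane) where
  card : ℕ
  elem : Fin card → SimplePolygon
  subset : ∀ K, (elem K).region ⊆ Ω
  disjoint : ∀ K L, K ≠ L → Disjoint (elem K).region (elem L).region
  cover : closure Ω = ⋃ K, closure (elem K).region
  conforming : ∀ K i, (elem K).poly.edgeSet ℝ i ⊆ frontier Ω ∨
    ∃ L, L ≠ K ∧ ∃ j, SameEdge (elem K) i (elem L) j

/-- Clamped, Navier (simply supported) and Cahn--Hilliard boundary conditions. -/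
inductive BC
  | CP
  | NC
  | CH

variable {Ω : Set Plane}

/-- The restriction of a function on `Ω` to an element. -/
def PolyMesh.res (T : PolyMesh Ω) (K : Fin T.card) : L2 Ω →ₗ[ℝ] L2 (T.elem K).region :=
  restrictL (T.subset K)

/-- The normal derivative, on the `i`-th edge of the element `K` and with respect to the normal
`edgeNormal i` of `K`, of a function whose gradient has the trace `γ` (taken from `K` or from the
neighbouring element). -/
def PolyMesh.normalTrace (T : PolyMesh Ω) (K : Fin T.card) (i : Fin (T.elem K).n)
    (γ : Fin 2 → Plane → ℝ) (x : Plane) : ℝ :=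
  ∑ j, (T.elem K).edgeNormal i j * γ j x

/-- The vertex and edge conditions in the `H²`-nonconforming space of order `k`, for a piecewise
`H²` function with boundary values `c K` and gradient traces `γ K` on the elements `K`.
Here `Polynomial.degreeLT ℝ (k - 2)` is `ℙ_{k-3}(e)`, which is `{0}` for `k = 2`, and
`Polynomial.degreeLT ℝ (k - 1)` is `ℙ_{k-2}(e)`. -/
structure JumpConditions (T : PolyMesh Ω) (bc : BC) (k : ℕ)
    (c : Fin T.card → Plane → ℝ) (γ : Fin T.card → Fin 2 → Plane → ℝ) : Prop where
  vertex : ∀ K i L j, (T.elem K).poly i = (T.elem L).poly j →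
    (bc = BC.CH ∨ (T.elem K).poly i ∉ frontier Ω) →
      c K ((T.elem K).poly i) = c L ((T.elem K).poly i)
  vertex_bdry : bc ≠ BC.CH → ∀ K i, (T.elem K).poly i ∈ frontier Ω →
    c K ((T.elem K).poly i) = 0
  value : ∀ K i L j, K ≠ L → SameEdge (T.elem K) i (T.elem L) j →
    ∀ p ∈ Polynomial.degreeLT ℝ (k - 2),
      (T.elem K).edgeMoment i (fun x => c K x - c L x) p = 0
  value_bdry : bc ≠ BC.CH → ∀ K i, (T.elem K).poly.edgeSet ℝ i ⊆ frontier Ω →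
    ∀ p ∈ Polynomial.degreeLT ℝ (k - 2), (T.elem K).edgeMoment i (c K) p = 0
  normal : ∀ K i L j, K ≠ L → SameEdge (T.elem K) i (T.elem L) j →
    ∀ q ∈ Polynomial.degreeLT ℝ (k - 1),
      (T.elem K).edgeMoment i
        (fun x => T.normalTrace K i (γ K) x - T.normalTrace K i (γ L) x) q = 0
  normal_bdry : ∀ K i, (T.elem K).poly.edgeSet ℝ i ⊆ frontier Ω →
    ∀ q ∈ Polynomial.degreeLT ℝ (k - 1),
      (T.elem K).edgeMoment i (T.normalTrace K i (γ K)) q = 0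

/-- Membership in the `H²`-nonconforming space of order `k`. -/
def IsNonconforming (T : PolyMesh Ω) (bc : BC) (k : ℕ) (v : L2 Ω) : Prop :=
  (∀ K, T.res K v ∈ H2 (T.elem K).region) ∧
  ∃ (c : Fin T.card → Plane → ℝ) (γ : Fin T.card → Fin 2 → Plane → ℝ),
    (∀ K, HasContRep (T.elem K).region (T.res K v) (c K)) ∧
    (∀ K i, (T.elem K).HasBdryTrace (weakDeriv (T.elem K).region i (T.res K v)) (γ K i)) ∧
    JumpConditions T bc k c γ

/-- Integrability on an edge. -/
def SimplePolygon.EdgeIntegrable (P : SimplePolygon) (i : Fin P.n) (g : Plane → ℝ) : Prop :=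
  IntervalIntegrable (fun t => g (P.poly.edgePath ℝ i t)) volume 0 1

theorem SimplePolygon.edgeMoment_comb (P : SimplePolygon) (i : Fin P.n) {g h : Plane → ℝ}
    (a b : ℝ) (p : Polynomial ℝ) (hg : P.EdgeIntegrable i g) (hh : P.EdgeIntegrable i h) :
    P.edgeMoment i (fun x => a * g x + b * h x) p
      = a * P.edgeMoment i g p + b * P.edgeMoment i h p := by
  have ig := (hg.mul_continuousOn (g := fun t => p.eval t) p.continuous.continuousOn).const_mul a
  have ih := (hh.mul_continuousOn (g := fun t => p.eval t) p.continuous.continuousOn).const_mul b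
  unfold SimplePolygon.edgeMoment
  have e : ∀ t : ℝ, (a * g (P.poly.edgePath ℝ i t) + b * h (P.poly.edgePath ℝ i t)) * p.eval t
      = a * (g (P.poly.edgePath ℝ i t) * p.eval t)
        + b * (h (P.poly.edgePath ℝ i t) * p.eval t) := fun t => by ring
  simp only [e]
  rw [intervalIntegral.integral_add ig ih, intervalIntegral.integral_const_mul,
    intervalIntegral.integral_const_mul]
  ring

theorem SimplePolygon.EdgeIntegrable.comb {P : SimplePolygon} {i : Fin P.n} {g h : Plane → ℝ}
    (a b : ℝ) (hg : P.EdgeIntegrable i g) (hh : P.EdgeIntegrable i h) :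
    P.EdgeIntegrable i (fun x => a * g x + b * h x) :=
  (hg.const_mul a).add (hh.const_mul b)

theorem SimplePolygon.EdgeIntegrable.sub {P : SimplePolygon} {i : Fin P.n} {g h : Plane → ℝ}
    (hg : P.EdgeIntegrable i g) (hh : P.EdgeIntegrable i h) :
    P.EdgeIntegrable i (fun x => g x - h x) :=
  IntervalIntegrable.sub hg hh

theorem HasContRep.edgeIntegrable {P : SimplePolygon} {w : L2 P.region} {c : Plane → ℝ}
    (hc : HasContRep P.region w c) (i : Fin P.n) : P.EdgeIntegrable i c := by
  refine ContinuousOn.intervalIntegrable ?_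
  refine hc.1.comp (AffineMap.lineMap_continuous.continuousOn) ?_
  intro t ht
  rw [uIcc_of_le zero_le_one] at ht
  apply frontier_subset_closure
  rw [P.frontier_region]
  exact mem_iUnion.2 ⟨i, mem_image_of_mem _ ht⟩

theorem HasTrace.edgeIntegrable {P : SimplePolygon} {w : L2 P.region} {γ : Plane → ℝ}
    (h : P.HasBdryTrace w γ) (i : Fin P.n) : P.EdgeIntegrable i γ := by
  have h1 := (h i).2.1
  have h2 := h1.integrable (by norm_num)
  unfold SimplePolygon.EdgeIntegrable
  rw [intervalIntegrable_iff_integrableOn_Icc_of_le zero_le_one]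
  exact h2

theorem SameEdge.edgeIntegrable {P Q : SimplePolygon} {i : Fin P.n} {j : Fin Q.n}
    (h : SameEdge P i Q j) {g : Plane → ℝ} (hg : Q.EdgeIntegrable j g) :
    P.EdgeIntegrable i g := by
  rcases h with ⟨h1, h2⟩ | ⟨h1, h2⟩
  · unfold SimplePolygon.EdgeIntegrable at hg ⊢
    simp only [Polygon.edgePath] at hg ⊢
    rw [h1, h2]
    exact hg
  · unfold SimplePolygon.EdgeIntegrable at hg ⊢
    have h3 := (hg.comp_sub_left 1).symm
    simp only [sub_self, sub_zero] at h3
    simp only [Polygon.edgePath] at h3 ⊢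
    rw [h1, h2]
    simpa only [AffineMap.lineMap_apply_one_sub] using h3

theorem PolyMesh.normalTrace_comb (T : PolyMesh Ω) (K : Fin T.card) (i : Fin (T.elem K).n)
    (a b : ℝ) (γ δ : Fin 2 → Plane → ℝ) (x : Plane) :
    T.normalTrace K i (fun j x => a * γ j x + b * δ j x) x
      = a * T.normalTrace K i γ x + b * T.normalTrace K i δ x := by
  simp only [PolyMesh.normalTrace, Fin.sum_univ_two]
  ring

theorem PolyMesh.normalTrace_edgeIntegrable (T : PolyMesh Ω) (K : Fin T.card)
    (i : Fin (T.elem K).n) {γ : Fin 2 → Plane → ℝ}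
    (h : ∀ j, (T.elem K).EdgeIntegrable i (γ j)) :
    (T.elem K).EdgeIntegrable i (T.normalTrace K i γ) := by
  have h0 := SimplePolygon.EdgeIntegrable.comb ((T.elem K).edgeNormal i 0)
    ((T.elem K).edgeNormal i 1) (h 0) (h 1)
  have e : T.normalTrace K i γ = fun x => (T.elem K).edgeNormal i 0 * γ 0 x
      + (T.elem K).edgeNormal i 1 * γ 1 x := by
    funext x
    simp only [PolyMesh.normalTrace, Fin.sum_univ_two]
  rw [e]
  exact h0

theorem IsNonconforming.zero (T : PolyMesh Ω) (bc : BC) (k : ℕ) :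
    IsNonconforming T bc k (0 : L2 Ω) := by
  refine ⟨fun K => ?_, fun _ _ => 0, fun _ _ _ => 0, fun K => ?_, fun K i => ?_, ?_⟩
  · rw [map_zero]
    exact zero_mem _
  · rw [map_zero]
    exact HasContRep.zero _
  · rw [map_zero, (HasWeakDeriv.zero _ i).weakDeriv_eq (T.elem K).isOpen_region]
    exact fun j => HasTrace.zero (T.elem K).isOpen_region _ _
  · constructor <;> intros <;> simp [SimplePolygon.edgeMoment, PolyMesh.normalTrace]

theorem IsNonconforming.comb {T : PolyMesh Ω} {bc : BC} {k : ℕ} {u v : L2 Ω} (a b : ℝ)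
    (hu : IsNonconforming T bc k u) (hv : IsNonconforming T bc k v) :
    IsNonconforming T bc k (a • u + b • v) := by
  obtain ⟨hu2, c, γ, hc, hγ, hJ⟩ := hu
  obtain ⟨hv2, d, δ, hd, hδ, hI⟩ := hv
  have hres : ∀ K, T.res K (a • u + b • v) = a • T.res K u + b • T.res K v := by
    intro K
    rw [map_add, map_smul, map_smul]
  have Ic : ∀ K i, (T.elem K).EdgeIntegrable i (c K) := fun K i => (hc K).edgeIntegrable i
  have Id : ∀ K i, (T.elem K).EdgeIntegrable i (d K) := fun K i => (hd K).edgeIntegrable i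
  have Ig : ∀ K i j, (T.elem K).EdgeIntegrable i (γ K j) :=
    fun K i j => HasTrace.edgeIntegrable (hγ K j) i
  have Ie : ∀ K i j, (T.elem K).EdgeIntegrable i (δ K j) :=
    fun K i j => HasTrace.edgeIntegrable (hδ K j) i
  refine ⟨fun K => ?_, fun K x => a * c K x + b * d K x,
    fun K j x => a * γ K j x + b * δ K j x, fun K => ?_, fun K j => ?_, ?_⟩
  · rw [hres]
    exact add_mem (Submodule.smul_mem _ a (hu2 K)) (Submodule.smul_mem _ b (hv2 K))
  · rw [hres]
    exact (hc K).comb a b (hd K)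
  · rw [hres, weakDeriv_comb (T.elem K).isOpen_region j a b (H2_le_H1 _ (hu2 K))
      (H2_le_H1 _ (hv2 K))]
    exact fun i => (hγ K j i).comb (T.elem K).isOpen_region a b (hδ K j i)
  · refine ⟨?_, ?_, ?_, ?_, ?_, ?_⟩
    · intro K i L j h1 h2
      simp only [hJ.vertex K i L j h1 h2, hI.vertex K i L j h1 h2]
    · intro hbc K i h1
      simp only [hJ.vertex_bdry hbc K i h1, hI.vertex_bdry hbc K i h1]
      ring
    · intro K i L j hKL hs p hp
      have J1 := hJ.value K i L j hKL hs p hp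
      have I1 := hI.value K i L j hKL hs p hp
      have e : (fun x => (a * c K x + b * d K x) - (a * c L x + b * d L x))
          = fun x => a * (c K x - c L x) + b * (d K x - d L x) := by
        funext x
        ring
      rw [e, SimplePolygon.edgeMoment_comb _ i a b p
        (SimplePolygon.EdgeIntegrable.sub (Ic K i) (hs.edgeIntegrable (Ic L j)))
        (SimplePolygon.EdgeIntegrable.sub (Id K i) (hs.edgeIntegrable (Id L j))), J1, I1]
      ring
    · intro hbc K i hs p hp
      rw [SimplePolygon.edgeMoment_comb _ i a b p (Ic K i) (Id K i),
        hJ.value_bdry hbc K i hs p hp, hI.value_bdry hbc K i hs p hp]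
      ring
    · intro K i L j hKL hs q hq
      have J1 := hJ.normal K i L j hKL hs q hq
      have I1 := hI.normal K i L j hKL hs q hq
      simp only [PolyMesh.normalTrace_comb]
      have e : (fun x => (a * T.normalTrace K i (γ K) x + b * T.normalTrace K i (δ K) x)
            - (a * T.normalTrace K i (γ L) x + b * T.normalTrace K i (δ L) x))
          = fun x => a * (T.normalTrace K i (γ K) x - T.normalTrace K i (γ L) x)
            + b * (T.normalTrace K i (δ K) x - T.normalTrace K i (δ L) x) := by
        funext x
        ring
      rw [e, SimplePolygon.edgeMoment_comb _ i a b q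
        (SimplePolygon.EdgeIntegrable.sub (T.normalTrace_edgeIntegrable K i (Ig K i))
          (T.normalTrace_edgeIntegrable K i fun m => hs.edgeIntegrable (Ig L j m)))
        (SimplePolygon.EdgeIntegrable.sub (T.normalTrace_edgeIntegrable K i (Ie K i))
          (T.normalTrace_edgeIntegrable K i fun m => hs.edgeIntegrable (Ie L j m))), J1, I1]
      ring
    · intro K i hs q hq
      have e : T.normalTrace K i (fun j x => a * γ K j x + b * δ K j x)
          = fun x => a * T.normalTrace K i (γ K) x + b * T.normalTrace K i (δ K) x := by
        funext x
        exact T.normalTrace_comb K i a b (γ K) (δ K) x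
      simp only [e]
      rw [SimplePolygon.edgeMoment_comb _ i a b q (T.normalTrace_edgeIntegrable K i (Ig K i))
          (T.normalTrace_edgeIntegrable K i (Ie K i)), hJ.normal_bdry K i hs q hq,
        hI.normal_bdry K i hs q hq]
      ring

/-! ### The virtual element spaces and the discrete forms -/

/-- Local virtual element spaces of order `k`: finite dimensional subspaces of `H²(K)` that contain
`ℙ_k(K)`. -/
structure LocalSpaces (T : PolyMesh Ω) (k : ℕ) where
  loc : ∀ K : Fin T.card, Submodule ℝ (L2 (T.elem K).region)
  finiteDimensional : ∀ K, FiniteDimensional ℝ (loc K)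
  poly_le : ∀ K, (T.elem K).polySpace k ≤ loc K
  le_H2 : ∀ K, loc K ≤ H2 (T.elem K).region

variable {T : PolyMesh Ω} {k : ℕ}

namespace LocalSpaces

/-- The global virtual element space. -/
def global (W : LocalSpaces T k) (bc : BC) : Submodule ℝ (L2 Ω) where
  carrier := {v | IsNonconforming T bc k v ∧ ∀ K, T.res K v ∈ W.loc K}
  add_mem' := fun {u v} hu hv => by
    refine ⟨?_, fun K => ?_⟩
    · have h := hu.1.comb 1 1 hv.1
      simpa only [one_smul] using h
    · rw [map_add]
      exact add_mem (hu.2 K) (hv.2 K)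
  zero_mem' := ⟨IsNonconforming.zero T bc k, fun K => by
    rw [map_zero]
    exact zero_mem _⟩
  smul_mem' := fun a v hv => by
    refine ⟨?_, fun K => ?_⟩
    · have h := hv.1.comb a 0 hv.1
      simpa only [zero_smul, add_zero] using h
    · rw [map_smul]
      exact Submodule.smul_mem _ a (hv.2 K)

/-- The restriction of a global function to an element. -/
def res (W : LocalSpaces T k) (bc : BC) (K : Fin T.card) (v : W.global bc) : W.loc K :=
  ⟨T.res K v, v.2.2 K⟩

/-- Polynomials as elements of the local space. -/
def ofPoly (W : LocalSpaces T k) (K : Fin T.card) (p : (T.elem K).polySpace k) : W.loc K :=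
  Submodule.inclusion (W.poly_le K) p

/-- A family of stabilization forms relative to local forms `a K` and local projections `π K`:
symmetric positive definite bilinear forms, equivalent to `a K` on the kernel of `π K` with positive
constants that do not depend on the element. -/
structure IsStabilization (W : LocalSpaces T k)
    (a : ∀ K, L2 (T.elem K).region → L2 (T.elem K).region → ℝ)
    (π : ∀ K, L2 (T.elem K).region → (T.elem K).polySpace k)
    (S : ∀ K, W.loc K →ₗ[ℝ] W.loc K →ₗ[ℝ] ℝ) : Prop where
  symm : ∀ K v w, S K v w = S K w v
  pos : ∀ K v, v ≠ 0 → 0 < S K v v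
  equiv : ∃ c C : ℝ, 0 < c ∧ 0 < C ∧ ∀ K (v : W.loc K), π K v = 0 →
    c * a K v v ≤ S K v v ∧ S K v v ≤ C * a K v v

end LocalSpaces

/-- A nonconforming virtual element discretization of order `k`: local spaces and stabilization
forms for the `L²`, `H¹` and `H²` products. -/
structure VEM (T : PolyMesh Ω) (k : ℕ) extends LocalSpaces T k where
  S0 : ∀ K, loc K →ₗ[ℝ] loc K →ₗ[ℝ] ℝ
  Sgrad : ∀ K, loc K →ₗ[ℝ] loc K →ₗ[ℝ] ℝ
  Shess : ∀ K, loc K →ₗ[ℝ] loc K →ₗ[ℝ] ℝ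
  stab0 : toLocalSpaces.IsStabilization
    (fun K => (T.elem K).formM) (fun K => (T.elem K).projL2 k) S0
  stabGrad : toLocalSpaces.IsStabilization
    (fun K => (T.elem K).formB) (fun K => (T.elem K).projGrad k) Sgrad
  stabHess : toLocalSpaces.IsStabilization
    (fun K => (T.elem K).formA) (fun K => (T.elem K).projHess k) Shess

namespace VEM

/-- The local form `M_h^K`. -/
def locM (V : VEM T k) (K : Fin T.card) (v w : V.loc K) : ℝ :=
  (T.elem K).formM ((T.elem K).projL2 k v) ((T.elem K).projL2 k w) +
    V.S0 K (v - V.ofPoly K ((T.elem K).projL2 k v)) (w - V.ofPoly K ((T.elem K).projL2 k w))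

/-- The local form `B_h^K`; the projection of the gradient onto the vector polynomials of degree at
most `k - 1` acts on each component. -/
def locB (V : VEM T k) (K : Fin T.card) (v w : V.loc K) : ℝ :=
  (∑ i, (T.elem K).formM ((T.elem K).projL2 (k - 1) (weakDeriv (T.elem K).region i v))
      ((T.elem K).projL2 (k - 1) (weakDeriv (T.elem K).region i w))) +
    V.Sgrad K (v - V.ofPoly K ((T.elem K).projGrad k v))
      (w - V.ofPoly K ((T.elem K).projGrad k w))

/-- The local form `A_h^K`. -/
def locA (V : VEM T k) (K : Fin T.card) (v w : V.loc K) : ℝ :=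
  (T.elem K).formA ((T.elem K).projHess k v) ((T.elem K).projHess k w) +
    V.Shess K (v - V.ofPoly K ((T.elem K).projHess k v))
      (w - V.ofPoly K ((T.elem K).projHess k w))

/-- The local semilinear form `F_h^K(v; w) = (Π^k f(Π^k v), w)_K`. -/
def locF (V : VEM T k) (f : ℝ → ℝ) (K : Fin T.card) (v w : V.loc K) : ℝ :=
  (T.elem K).formM
    ((T.elem K).projL2 k (toL2 (T.elem K).region
      (fun x => f (((T.elem K).projL2 k v : L2 (T.elem K).region) x)))) w

variable (V : VEM T k) (bc : BC)

/-- `M_h`. -/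
def formM (v w : V.global bc) : ℝ := ∑ K, V.locM K (V.res bc K v) (V.res bc K w)

/-- `A_h`. -/
def formA (v w : V.global bc) : ℝ := ∑ K, V.locA K (V.res bc K v) (V.res bc K w)

/-- `B_h`. -/
def formB (v w : V.global bc) : ℝ := ∑ K, V.locB K (V.res bc K v) (V.res bc K w)

/-- `F_h`. -/
def formF (f : ℝ → ℝ) (v w : V.global bc) : ℝ :=
  ∑ K, V.locF f K (V.res bc K v) (V.res bc K w)

/-- `Clow` and `Cup` are a coercivity and a continuity constant of `M_h` in `L²(Ω)`. -/
def MassConstants (Clow Cup : ℝ) : Prop :=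
  0 < Clow ∧ 0 < Cup ∧
  (∀ v w : V.global bc, |V.formM bc v w| ≤ Cup * ‖v‖ * ‖w‖) ∧
  (∀ v : V.global bc, Clow * ‖v‖ ^ 2 ≤ V.formM bc v v)

/-- One step of the backward Euler scheme: `u` solves the discrete problem when `uprev` is the
solution at the previous time. -/
def IsEulerStep (α₁ α₂ : ℝ) (f : ℝ → ℝ) (dt : ℝ) (uprev u : V.global bc) : Prop :=
  ∀ v : V.global bc,
    V.formM bc (dt⁻¹ • (u - uprev)) v + α₁ * V.formA bc u v + α₂ * V.formB bc u v
      = V.formF bc f u v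

end VEM

end NCVEM

end

namespace NCVEM

/-! ### Uniqueness of traces -/

/-! One Euler step is a semilinear equation `G u = F u` on a finite-dimensional space. Here `G` is
`Δt⁻¹ M_h + α₁ A_h + α₂ B_h`, and `F u` is `F_h(u; ·)` plus the fixed functional `Δt⁻¹ M_h(u_prev,
·)`. Since `A_h` and `B_h` are positive semidefinite, `G` is coercive with constant `C_{M,*}/Δt`.
The `L²` projections around `f` are nonexpansive, so `F` is Lipschitz with constant `L_f`. Hence `u
↦ G⁻¹ F(u)` contracts with factor `L_f Δt / C_{M,*} < 1/2`, and Banach's theorem gives the unique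
solution (`existsUnique_semilinear`, `existsUnique_isEulerStep`).

The mass bounds (1) come from Pythagoras on each element and the equivalence of `S_0^K` with the
`L²` product on `ker Π^k` (`exists_locM_bounds`). They are summed over the mesh, whose elements fill
`Ω` up to a null set.

Most of the work is the bilinearity of `A_h` and `B_h`. The seminorm projections are fixed by
boundary means, which are computed from an arbitrarily chosen continuous representative or trace.
Linearity requires these means to be independent of the choice. For representatives this is
continuity. For traces it follows from an `L¹` trace inequality on half boxes along the edges
(`hasBdryTrace_zero_ae`). The projections are then characterized as the linear maps produced by
`exists_projection`, on the space of functions having such boundary data; restrictions of discrete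
functions belong to it by definition of the nonconforming space. -/

theorem enorm_le_add_lintegral_deriv {g g' : ℝ → ℝ} (hg : ∀ s, HasDerivAt g (g' s) s)
    (hg' : Continuous g') {ε s : ℝ} (hs : s ∈ Ioo 0 ε) :
    ‖g 0‖ₑ ≤ ‖g s‖ₑ + ∫⁻ r in Ioo 0 ε, ‖g' r‖ₑ := by
  have h1 : ∫ r in (0 : ℝ)..s, g' r = g s - g 0 :=
    intervalIntegral.integral_eq_sub_of_hasDerivAt (fun x _ => hg x)
      (hg'.intervalIntegrable _ _)
  have h2 : g 0 = g s - ∫ r in (0 : ℝ)..s, g' r := by rw [h1]; ring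
  calc ‖g 0‖ₑ ≤ ‖g s‖ₑ + ‖∫ r in (0 : ℝ)..s, g' r‖ₑ := by
        nth_rewrite 1 [h2]
        exact enorm_sub_le
    _ ≤ _ := by
        gcongr
        rw [intervalIntegral.integral_of_le hs.1.le]
        refine (enorm_integral_le_lintegral_enorm _).trans ?_
        exact lintegral_mono_set fun r hr => ⟨hr.1, hr.2.trans_lt hs.2⟩

/-- Integrating the previous pointwise bound over `s` in `(0, ε)` trades the value at one point for
integrals over the interval. -/
theorem mul_enorm_le_lintegral_add {g g' : ℝ → ℝ} (hg : ∀ s, HasDerivAt g (g' s) s)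
    (hg' : Continuous g') (ε : ℝ) :
    ENNReal.ofReal ε * ‖g 0‖ₑ ≤ (∫⁻ r in Ioo 0 ε, ‖g r‖ₑ)
      + ENNReal.ofReal ε * ∫⁻ r in Ioo 0 ε, ‖g' r‖ₑ := by
  have hgc : Continuous g := continuous_iff_continuousAt.2 fun s => (hg s).continuousAt
  have h1 : ∫⁻ _ in Ioo 0 ε, ‖g 0‖ₑ
      ≤ ∫⁻ s in Ioo 0 ε, (‖g s‖ₑ + ∫⁻ r in Ioo 0 ε, ‖g' r‖ₑ) :=
    setLIntegral_mono' measurableSet_Ioo fun s hs => enorm_le_add_lintegral_deriv hg hg' hs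
  rw [lintegral_add_left hgc.enorm.measurable, lintegral_const, lintegral_const] at h1
  simp only [Measure.restrict_apply_univ, Real.volume_Ioo, sub_zero] at h1
  rwa [mul_comm (‖g 0‖ₑ), mul_comm (lintegral _ _) (ENNReal.ofReal ε)] at h1

/-- The image of Lebesgue measure under a linear isomorphism is a Haar measure, hence a multiple of
Lebesgue measure. The factor depends on `e` alone, and translation by `a` costs nothing. -/
theorem exists_lintegral_comp_linear_le (e : (ℝ × ℝ) ≃L[ℝ] Plane) :
    ∃ C : NNReal, ∀ (a : Plane) (D : Set Plane) (S : Set (ℝ × ℝ)) (h : Plane → ENNReal),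
      MeasurableSet D → MeasurableSet S → Measurable h → (∀ p ∈ S, a + e p ∈ D) →
      ∫⁻ p in S, h (a + e p) ≤ C * ∫⁻ x in D, h x := by
  have : (Measure.map e (volume : Measure (ℝ × ℝ))).IsAddHaarMeasure :=
    e.isAddHaarMeasure_map volume
  obtain ⟨c, hmap⟩ : ∃ c : NNReal, Measure.map e (volume : Measure (ℝ × ℝ)) = c • volume :=
    ⟨_, Measure.isAddLeftInvariant_eq_smul _ _⟩
  refine ⟨c, fun a D S h hD hS hh hSD => ?_⟩
  calc ∫⁻ p in S, h (a + e p) = ∫⁻ p, S.indicator (fun p => h (a + e p)) p := by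
        rw [lintegral_indicator hS]
    _ ≤ ∫⁻ p, D.indicator h (a + e p) := by
        refine lintegral_mono fun p => ?_
        by_cases hp : p ∈ S
        · rw [indicator_of_mem hp, indicator_of_mem (hSD p hp)]
        · rw [indicator_of_notMem hp]
          exact zero_le
    _ = ∫⁻ y, D.indicator h (a + y) ∂(Measure.map e volume) := by
        rw [lintegral_map (f := fun y => D.indicator h (a + y))
          ((hh.indicator hD).comp (measurable_const_add a)) e.continuous.measurable]
    _ = _ := by
        rw [hmap, lintegral_smul_measure, lintegral_add_left_eq_self (D.indicator h) a,
          lintegral_indicator hD]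
        rfl

/-- An `L¹` trace inequality on one side of a segment. -/
theorem exists_lintegral_edge_le (e : (ℝ × ℝ) ≃L[ℝ] Plane) {ε : ℝ} (hε : 0 < ε) :
    ∃ C : ENNReal, C ≠ ⊤ ∧ ∀ (a : Plane) (D : Set Plane) (I : Set ℝ) (φ : Plane → ℝ),
      MeasurableSet D → MeasurableSet I → ContDiff ℝ ∞ φ →
      (∀ t ∈ I, ∀ s ∈ Ioo 0 ε, a + e (t, s) ∈ D) →
      ∫⁻ t in I, ‖φ (a + e (t, 0))‖ₑ
        ≤ C * ((∫⁻ x in D, ‖φ x‖ₑ) + ∑ i, ∫⁻ x in D, ‖pderiv i φ x‖ₑ) := by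
  obtain ⟨C, hC⟩ := exists_lintegral_comp_linear_le e
  set n : Plane := e (0, 1) with hn
  -- The factor `1/ε` undoes the averaging across the edge, `C` is the change-of-variables factor,
  -- and the components of the transversal vector `n` bound the derivative along `n` by the two
  -- partial derivatives.
  refine ⟨(ENNReal.ofReal ε)⁻¹ * (C * (1 + ENNReal.ofReal ε * (‖n 0‖ₑ + ‖n 1‖ₑ))),
    by finiteness, fun a D I φ hD hI hφ hsub => ?_⟩
  have hφd : ∀ x, DifferentiableAt ℝ φ x := fun x =>
    (hφ.differentiable (by simp)).differentiableAt
  set dn : Plane → ℝ := fun x => n 0 * pderiv 0 φ x + n 1 * pderiv 1 φ x with hdn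
  have hdc : Continuous dn := ((pderiv_continuous 0 hφ).const_smul (n 0)).add
    ((pderiv_continuous 1 hφ).const_smul (n 1))
  have hdn' : ∀ x, fderiv ℝ φ x n = dn x := by
    intro x
    have h : ∀ y : Plane,
        y = y 0 • EuclideanSpace.single 0 1 + y 1 • EuclideanSpace.single 1 1 := by
      intro y
      ext i
      fin_cases i <;> simp
    rw [h n, map_add, map_smul, map_smul]
    simp [hdn, pderiv]
  have hΨ : Continuous fun p : ℝ × ℝ => a + e p := continuous_const.add e.continuous
  have hder : ∀ t s, HasDerivAt (fun s => φ (a + e (t, s))) (dn (a + e (t, s))) s := by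
    intro t s
    have h1 : HasDerivAt (fun s : ℝ => a + e (t, s)) n s := by
      have e1 : (fun s : ℝ => a + e (t, s)) = fun s : ℝ => a + e (t, 0) + s • n := by
        funext s
        rw [hn, ← map_smul, add_assoc, ← map_add]
        simp
      rw [e1]
      simpa using ((hasDerivAt_id s).smul_const n).const_add (a + e (t, 0))
    rw [← hdn']
    exact (hφd _).hasFDerivAt.comp_hasDerivAt s h1
  have hcont : ∀ t, Continuous fun s => dn (a + e (t, s)) := fun t =>
    hdc.comp (hΨ.comp (by fun_prop))
  have hS : MeasurableSet (I ×ˢ Ioo (0 : ℝ) ε) := hI.prod measurableSet_Ioo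
  have hSD : ∀ p ∈ I ×ˢ Ioo (0 : ℝ) ε, a + e p ∈ D := fun p hp => hsub p.1 hp.1 p.2 hp.2
  have hprod : ∀ h : Plane → ENNReal, Measurable h →
      ∫⁻ t in I, ∫⁻ s in Ioo 0 ε, h (a + e (t, s)) ≤ C * ∫⁻ x in D, h x := by
    intro h hh
    refine le_trans (le_of_eq ?_) (hC a D _ h hD hS hh hSD)
    rw [Measure.volume_eq_prod, ← Measure.prod_restrict,
      lintegral_prod (fun p : ℝ × ℝ => h (a + e p)) (hh.comp hΨ.measurable).aemeasurable]
  have hmeas : ∀ h : Plane → ENNReal, Measurable h →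
      Measurable fun t => ∫⁻ s in Ioo 0 ε, h (a + e (t, s)) := fun h hh =>
    (hh.comp hΨ.measurable).lintegral_prod_right'
  -- The one-dimensional estimate on each transversal segment, integrated along the edge.
  have key : ENNReal.ofReal ε * ∫⁻ t in I, ‖φ (a + e (t, 0))‖ₑ
      ≤ C * (∫⁻ x in D, ‖φ x‖ₑ) + ENNReal.ofReal ε * (C * ∫⁻ x in D, ‖dn x‖ₑ) := by
    calc ENNReal.ofReal ε * ∫⁻ t in I, ‖φ (a + e (t, 0))‖ₑ
        = ∫⁻ t in I, ENNReal.ofReal ε * ‖φ (a + e (t, 0))‖ₑ := by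
          rw [lintegral_const_mul']
          exact ENNReal.ofReal_ne_top
      _ ≤ ∫⁻ t in I, ((∫⁻ s in Ioo 0 ε, ‖φ (a + e (t, s))‖ₑ)
            + ENNReal.ofReal ε * ∫⁻ s in Ioo 0 ε, ‖dn (a + e (t, s))‖ₑ) :=
          lintegral_mono fun t => mul_enorm_le_lintegral_add (hder t) (hcont t) ε
      _ = (∫⁻ t in I, ∫⁻ s in Ioo 0 ε, ‖φ (a + e (t, s))‖ₑ)
            + ENNReal.ofReal ε * ∫⁻ t in I, ∫⁻ s in Ioo 0 ε, ‖dn (a + e (t, s))‖ₑ := by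
          rw [lintegral_add_left (hmeas _ hφ.continuous.enorm.measurable),
            lintegral_const_mul']
          exact ENNReal.ofReal_ne_top
      _ ≤ _ := by
          gcongr
          · exact hprod _ hφ.continuous.enorm.measurable
          · exact hprod _ hdc.enorm.measurable
  have hdbound : ∫⁻ x in D, ‖dn x‖ₑ
      ≤ (‖n 0‖ₑ + ‖n 1‖ₑ) * ∑ i, ∫⁻ x in D, ‖pderiv i φ x‖ₑ := by
    calc ∫⁻ x in D, ‖dn x‖ₑ
        ≤ ∫⁻ x in D, (‖n 0‖ₑ * ‖pderiv 0 φ x‖ₑ + ‖n 1‖ₑ * ‖pderiv 1 φ x‖ₑ) := by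
          refine lintegral_mono fun x => ?_
          refine (enorm_add_le _ _).trans ?_
          rw [enorm_mul, enorm_mul]
      _ = ‖n 0‖ₑ * (∫⁻ x in D, ‖pderiv 0 φ x‖ₑ) + ‖n 1‖ₑ * ∫⁻ x in D, ‖pderiv 1 φ x‖ₑ := by
          rw [lintegral_add_left ((pderiv_continuous 0 hφ).enorm.measurable.const_mul _),
            lintegral_const_mul' _ _ enorm_ne_top, lintegral_const_mul' _ _ enorm_ne_top]
      _ ≤ _ := by
          rw [add_mul, Fin.sum_univ_two]
          gcongr
          · exact le_self_add
          · exact le_add_self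
  set A := ∫⁻ x in D, ‖φ x‖ₑ
  set B := ∑ i, ∫⁻ x in D, ‖pderiv i φ x‖ₑ
  have hε0 : ENNReal.ofReal ε ≠ 0 := by simpa using hε
  have hfin : ∫⁻ t in I, ‖φ (a + e (t, 0))‖ₑ = (ENNReal.ofReal ε)⁻¹ *
      (ENNReal.ofReal ε * ∫⁻ t in I, ‖φ (a + e (t, 0))‖ₑ) := by
    rw [← mul_assoc, ENNReal.inv_mul_cancel hε0 ENNReal.ofReal_ne_top, one_mul]
  rw [hfin, mul_assoc]
  refine mul_le_mul' le_rfl ?_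
  refine key.trans ?_
  calc C * A + ENNReal.ofReal ε * (C * ∫⁻ x in D, ‖dn x‖ₑ)
      ≤ C * (A + B) + ENNReal.ofReal ε * (C * ((‖n 0‖ₑ + ‖n 1‖ₑ) * (A + B))) := by
        gcongr
        · exact le_self_add
        · exact hdbound.trans (by gcongr; exact le_add_self)
    _ = _ := by ring

/-- Hölder on a finite measure space: `L²` convergence implies `L¹` convergence, so the `L¹` trace
inequality suffices. -/
theorem tendsto_lintegral_enorm_of_tendsto_eLpNorm {α : Type*} [MeasurableSpace α]
    {μ : Measure α} [IsFiniteMeasure μ] {F : ℕ → α → ℝ}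
    (hF : ∀ m, AEStronglyMeasurable (F m) μ)
    (h : Tendsto (fun m => eLpNorm (F m) 2 μ) atTop (𝓝 0)) :
    Tendsto (fun m => ∫⁻ x, ‖F m x‖ₑ ∂μ) atTop (𝓝 0) := by
  have hc : μ Set.univ ^ (1 / (1 : ENNReal).toReal - 1 / (2 : ENNReal).toReal) ≠ ⊤ := by
    refine ENNReal.rpow_ne_top_of_nonneg (by norm_num) (measure_ne_top _ _)
  have h2 := ENNReal.Tendsto.mul_const (b := μ Set.univ ^
    (1 / (1 : ENNReal).toReal - 1 / (2 : ENNReal).toReal)) h (Or.inr hc)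
  rw [zero_mul] at h2
  refine tendsto_of_tendsto_of_tendsto_of_le_of_le tendsto_const_nhds h2
    (fun _ => zero_le) fun m => ?_
  rw [← eLpNorm_one_eq_lintegral_enorm]
  exact eLpNorm_le_eLpNorm_mul_rpow_measure_univ (by norm_num) (hF m)

/-- A trace of zero vanishes on the part of an edge that has the domain on one side. -/
theorem HasTrace.ae_eq_zero_of_half_box {D : Set Plane} (hD : IsOpen D)
    (hDb : Bornology.IsBounded D) {a b : Plane} {γ : Plane → ℝ} (h : HasTrace D a b 0 γ)
    (e : (ℝ × ℝ) ≃L[ℝ] Plane) (he : e (1, 0) = b - a) {ε : ℝ} (hε : 0 < ε) {I : Set ℝ}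
    (hI : MeasurableSet I) (hI01 : I ⊆ Icc 0 1)
    (hsub : ∀ t ∈ I, ∀ s ∈ Ioo 0 ε, a + e (t, s) ∈ D) :
    ∀ᵐ t ∂(volume.restrict I), γ (AffineMap.lineMap a b t) = 0 := by
  obtain ⟨-, gm, φ, φs, φ0, φ1, φt⟩ := h
  obtain ⟨C, hCt, hC⟩ := exists_lintegral_edge_le e hε
  have : IsFiniteMeasure (volume.restrict D) := ⟨by simpa using hDb.measure_lt_top⟩
  have hline : ∀ t : ℝ, a + e (t, 0) = AffineMap.lineMap a b t := by
    intro t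
    have : ((t, 0) : ℝ × ℝ) = t • (1, 0) := by simp
    rw [this, map_smul, he, AffineMap.lineMap_apply]
    simp [add_comm]
  have z0 : ∀ m, eLpNorm (φ m) 2 (volume.restrict D)
      = eLpNorm (fun x => φ m x - (0 : L2 D) x) 2 (volume.restrict D) := fun m => by
    refine eLpNorm_congr_ae ?_
    filter_upwards [Lp.coeFn_zero ℝ 2 (volume.restrict D)] with x hx
    rw [hx]
    simp
  have z1 : ∀ i m, eLpNorm (pderiv i (φ m)) 2 (volume.restrict D)
      = eLpNorm (fun x => pderiv i (φ m) x - weakDeriv D i 0 x) 2 (volume.restrict D) :=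
    fun i m => by
    rw [(HasWeakDeriv.zero D i).weakDeriv_eq hD]
    refine eLpNorm_congr_ae ?_
    filter_upwards [Lp.coeFn_zero ℝ 2 (volume.restrict D)] with x hx
    rw [hx]
    simp
  simp only [← z0] at φ0
  simp only [← z1] at φ1
  have t0 := tendsto_lintegral_enorm_of_tendsto_eLpNorm
    (fun m => (φs m).continuous.aestronglyMeasurable) φ0
  have t1 := fun i => tendsto_lintegral_enorm_of_tendsto_eLpNorm
    (fun m => (pderiv_continuous i (φs m)).aestronglyMeasurable) (φ1 i)
  have hlc : Continuous (fun t : ℝ => (AffineMap.lineMap a b t : Plane)) :=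
    AffineMap.lineMap_continuous
  have t2 := tendsto_lintegral_enorm_of_tendsto_eLpNorm
    (fun m => ((φs m).continuous.comp hlc).aestronglyMeasurable.sub gm.1) φt
  have t3 : Tendsto (fun m => C * ((∫⁻ x in D, ‖φ m x‖ₑ)
      + ∑ i, ∫⁻ x in D, ‖pderiv i (φ m) x‖ₑ)) atTop (𝓝 0) := by
    have := ENNReal.Tendsto.const_mul (a := C)
      (t0.add (tendsto_finsetSum Finset.univ fun i _ => t1 i)) (Or.inr hCt)
    simpa using this
  have t4 := t2.add t3
  rw [add_zero] at t4
  -- Split `γ = (γ - φ m) + φ m` on the edge. The first part tends to zero by the definition of a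
  -- trace, the second by the trace inequality, since `φ m` and its derivatives tend to zero in
  -- `L¹(D)`.
  have hzero : ∫⁻ t in I, ‖γ (AffineMap.lineMap a b t)‖ₑ = 0 := by
    refine le_antisymm (ge_of_tendsto' t4 fun m => ?_) zero_le
    have hle := hC a D I (φ m) hD.measurableSet hI (φs m) hsub
    simp only [hline] at hle
    calc ∫⁻ t in I, ‖γ (AffineMap.lineMap a b t)‖ₑ
        ≤ ∫⁻ t in I, (‖φ m (AffineMap.lineMap a b t) - γ (AffineMap.lineMap a b t)‖ₑ
            + ‖φ m (AffineMap.lineMap a b t)‖ₑ) := by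
          refine lintegral_mono fun t => ?_
          rw [← enorm_neg (_ - _), neg_sub]
          refine le_trans (le_of_eq ?_) (enorm_add_le _ _)
          rw [sub_add_cancel]
      _ = (∫⁻ t in I, ‖φ m (AffineMap.lineMap a b t) - γ (AffineMap.lineMap a b t)‖ₑ)
            + ∫⁻ t in I, ‖φ m (AffineMap.lineMap a b t)‖ₑ := by
          rw [lintegral_add_right _ (g := fun t => ‖φ m (AffineMap.lineMap a b t)‖ₑ)
            ((φs m).continuous.comp hlc).enorm.measurable]
      _ ≤ _ := add_le_add (lintegral_mono_set hI01) hle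
  have hgm : AEMeasurable (fun t => ‖γ (AffineMap.lineMap a b t)‖ₑ) (volume.restrict I) :=
    (gm.1.mono_measure (Measure.restrict_mono_set _ hI01)).enorm
  rw [lintegral_eq_zero_iff' hgm] at hzero
  filter_upwards [hzero] with t ht
  simpa using ht

end NCVEM

/-! ### Polygons near an edge -/

namespace NCVEM

/-- Linear coordinates of the plane along and across a nonzero vector. -/
theorem exists_linearEquiv_fst {d : Plane} (hd : d ≠ 0) :
    ∃ e : (ℝ × ℝ) ≃L[ℝ] Plane, e (1, 0) = d := by
  set n : Plane := !₂[-d 1, d 0] with hn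
  set f : (ℝ × ℝ) →ₗ[ℝ] Plane :=
    (LinearMap.toSpanSingleton ℝ Plane d).coprod (LinearMap.toSpanSingleton ℝ Plane n) with hf
  have hfa : ∀ p : ℝ × ℝ, f p = p.1 • d + p.2 • n := fun p => by simp [hf]
  -- This is the determinant of `f`, because `n` is `d` turned by a right angle.
  have hdd : d 0 * d 0 + d 1 * d 1 ≠ 0 := by
    intro h
    apply hd
    ext i
    fin_cases i
    · simpa using (by nlinarith [mul_self_nonneg (d 0), mul_self_nonneg (d 1)] : d 0 * d 0 = 0)
    · simpa using (by nlinarith [mul_self_nonneg (d 0), mul_self_nonneg (d 1)] : d 1 * d 1 = 0)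
  have hinj : Function.Injective f := by
    rw [← LinearMap.ker_eq_bot, LinearMap.ker_eq_bot']
    rintro ⟨t, s⟩ h
    rw [hfa] at h
    have h0 : t * d 0 - s * d 1 = 0 := by
      have := congrArg (fun y : Plane => y 0) h
      simp [hn] at this
      linarith
    have h1 : t * d 1 + s * d 0 = 0 := by
      have := congrArg (fun y : Plane => y 1) h
      simpa [hn] using this
    have ht : t * (d 0 * d 0 + d 1 * d 1) = 0 := by linear_combination d 0 * h0 + d 1 * h1
    have hs : s * (d 0 * d 0 + d 1 * d 1) = 0 := by linear_combination d 0 * h1 - d 1 * h0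
    rw [mul_eq_zero, or_iff_left hdd] at ht hs
    rw [ht, hs]
    rfl
  refine ⟨(f.linearEquivOfInjective hinj (by simp)).toContinuousLinearEquiv, ?_⟩
  show f (1, 0) = d
  simp [hfa]

/-- An open set whose frontier near a point of a line is contained in that line lies on one side
of it near the point. -/
theorem half_box_subset {D : Set (ℝ × ℝ)} (hD : IsOpen D) {t₀ δ : ℝ}
    (h0 : (t₀, (0 : ℝ)) ∈ closure D) (hδ : 0 < δ)
    (hf : ∀ p ∈ frontier D, p ∈ Metric.ball (t₀, (0 : ℝ)) δ → p.2 = 0) :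
    Metric.ball t₀ δ ×ˢ Ioo 0 δ ⊆ D ∨ Metric.ball t₀ δ ×ˢ Ioo (-δ) 0 ⊆ D := by
  -- A convex box off the line contains no frontier point, so connectedness puts it wholly inside
  -- `D` or wholly in the exterior.
  have hside : ∀ J : Set ℝ, Convex ℝ J → J ⊆ Metric.ball 0 δ → (0 : ℝ) ∉ J →
      Metric.ball t₀ δ ×ˢ J ⊆ D ∨ Metric.ball t₀ δ ×ˢ J ⊆ (closure D)ᶜ := by
    intro J hJ hJδ hJ0
    refine IsPreconnected.subset_or_subset hD isClosed_closure.isOpen_compl ?_ ?_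
      ((convex_ball t₀ δ).prod hJ).isPreconnected
    · exact disjoint_compl_right.mono_left subset_closure
    · intro p hp
      by_contra hpD
      rw [mem_union, not_or, mem_compl_iff, not_not] at hpD
      have hpf : p ∈ frontier D := by
        rw [hD.frontier_eq]
        exact ⟨hpD.2, hpD.1⟩
      have hpb : p ∈ Metric.ball (t₀, (0 : ℝ)) δ := by
        rw [← ball_prod_same]
        exact ⟨hp.1, hJδ hp.2⟩
      exact hJ0 (hf p hpf hpb ▸ hp.2)
  have hpos := hside (Ioo 0 δ) (convex_Ioo _ _)
    (fun s hs => by rw [Real.ball_eq_Ioo]; constructor <;> linarith [hs.1, hs.2]) (by simp)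
  have hneg := hside (Ioo (-δ) 0) (convex_Ioo _ _)
    (fun s hs => by rw [Real.ball_eq_Ioo]; constructor <;> linarith [hs.1, hs.2]) (by simp)
  rcases hpos with h | hp
  · exact Or.inl h
  rcases hneg with h | hn
  · exact Or.inr h
  -- If both half boxes were exterior, a point of `D` in the ball would lie on the line; openness of
  -- `D` then yields a point of `D` slightly above it, in an exterior half box.
  exfalso
  obtain ⟨p, hpD, hpb⟩ := Metric.mem_closure_iff.1 h0 δ hδ
  rw [dist_comm, ← Metric.mem_ball, ← ball_prod_same] at hpb
  obtain ⟨r, hr, hrD⟩ := Metric.isOpen_iff.1 hD p hpD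
  have hp2 : |p.2| < δ := by simpa using hpb.2
  have hp2z : p.2 = 0 := by
    rcases lt_trichotomy p.2 0 with h | h | h
    · exact absurd (subset_closure hpD) (hn ⟨hpb.1, (abs_lt.1 hp2).1, h⟩)
    · exact h
    · exact absurd (subset_closure hpD) (hp ⟨hpb.1, h, (abs_lt.1 hp2).2⟩)
  have hm : 0 < min r δ := lt_min hr hδ
  have hq : (p.1, min r δ / 2) ∈ D := by
    apply hrD
    rw [Metric.mem_ball, Prod.dist_eq, dist_self, hp2z, Real.dist_eq, sub_zero,
      abs_of_pos (by linarith)]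
    exact max_lt hr (by linarith [min_le_left r δ])
  exact hp (a := (p.1, min r δ / 2)) ⟨hpb.1, by simpa using hm,
    (half_lt_self hm).trans_le (min_le_right r δ)⟩ (subset_closure hq)

namespace SimplePolygon

variable (P : SimplePolygon)

/-- A degenerate edge would be a constant path, taking the same value at the parameters `0` and
`1/2`. -/
theorem poly_ne_next (i : Fin P.n) : P.poly i ≠ P.poly (finRotate P.n i) := by
  intro h
  have := (P.simple i i 0 (by simp) (1 / 2) (by norm_num) (by
    simp only [Polygon.edgePath]
    have h' : P.poly.vertices i = P.poly.vertices (finRotate P.n i) := h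
    rw [← h']
    simp)).2
  norm_num at this

theorem edgePath_notMem_edgeSet {i j : Fin P.n} (hij : j ≠ i) {t : ℝ} (ht : t ∈ Ioo (0 : ℝ) 1) :
    P.poly.edgePath ℝ i t ∉ P.poly.edgeSet ℝ j := by
  rintro ⟨s, hs, h⟩
  change P.poly.edgePath ℝ j s = P.poly.edgePath ℝ i t at h
  rcases hs.2.lt_or_eq with hs1 | rfl
  · exact hij (P.simple j i s ⟨hs.1, hs1⟩ t ⟨ht.1.le, ht.2⟩ h).1
  · have h' : P.poly.edgePath ℝ (finRotate P.n j) 0 = P.poly.edgePath ℝ i t := by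
      rw [← h]
      simp [Polygon.edgePath]
    exact ht.1.ne (P.simple _ i 0 (by simp) t ⟨ht.1.le, ht.2⟩ h').2

theorem isCompact_edgeSet (i : Fin P.n) : IsCompact (P.poly.edgeSet ℝ i) :=
  isCompact_Icc.image AffineMap.lineMap_continuous

theorem edgePath_mem_edgeSet (i : Fin P.n) {t : ℝ} (ht : t ∈ Icc (0 : ℝ) 1) :
    P.poly.edgePath ℝ i t ∈ P.poly.edgeSet ℝ i :=
  mem_image_of_mem _ ht

theorem edgeSet_subset_frontier (i : Fin P.n) : P.poly.edgeSet ℝ i ⊆ frontier P.region := by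
  rw [P.frontier_region]
  exact subset_iUnion (fun i => P.poly.edgeSet ℝ i) i

/-- Near an interior point of an edge, the polygon contains a half box along the edge. -/
theorem exists_half_box (i : Fin P.n) {t₀ : ℝ} (ht₀ : t₀ ∈ Ioo (0 : ℝ) 1) :
    ∃ e : (ℝ × ℝ) ≃L[ℝ] Plane, e (1, 0) = P.poly (finRotate P.n i) - P.poly i ∧
      ∃ δ > 0, ∀ t ∈ Metric.ball t₀ δ, ∀ s ∈ Ioo 0 δ, P.poly i + e (t, s) ∈ P.region := by
  obtain ⟨e, he⟩ := exists_linearEquiv_fst (sub_ne_zero.2 (P.poly_ne_next i).symm)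
  set a := P.poly i with ha
  set b := P.poly (finRotate P.n i) with hb
  have hline : ∀ t : ℝ, P.poly.edgePath ℝ i t = a + e (t, 0) := by
    intro t
    have : ((t, 0) : ℝ × ℝ) = t • (1, 0) := by simp
    rw [this, map_smul, he, Polygon.edgePath, AffineMap.lineMap_apply]
    simp only [vsub_eq_sub, vadd_eq_add]
    rw [add_comm]
  let Ψ : (ℝ × ℝ) ≃ₜ Plane := e.toHomeomorph.trans (Homeomorph.addLeft a)
  have hΨ : ∀ p, Ψ p = a + e p := fun p => rfl
  set D := Ψ ⁻¹' P.region with hD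
  have hDo : IsOpen D := P.isOpen_region.preimage Ψ.continuous
  -- The other edges form a closed set that misses the chosen point, so in a small ball the frontier
  -- consists of points of edge `i` only.
  have hO : IsClosed (⋃ j ∈ {j | j ≠ i}, P.poly.edgeSet ℝ j) :=
    (Set.toFinite _).isClosed_biUnion fun j _ => (P.isCompact_edgeSet j).isClosed
  have hx : Ψ (t₀, 0) ∉ ⋃ j ∈ {j | j ≠ i}, P.poly.edgeSet ℝ j := by
    rw [hΨ, ← hline]
    simp only [mem_iUnion, not_exists]
    exact fun j hj => P.edgePath_notMem_edgeSet hj ht₀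
  obtain ⟨δ, hδ, hball⟩ := Metric.mem_nhds_iff.1
    (Ψ.continuous.continuousAt.preimage_mem_nhds (hO.isOpen_compl.mem_nhds hx))
  have hcl : (t₀, (0 : ℝ)) ∈ closure D := by
    rw [hD, ← Ψ.preimage_closure]
    refine frontier_subset_closure (P.edgeSet_subset_frontier i ?_)
    rw [hΨ, ← hline]
    exact P.edgePath_mem_edgeSet i ⟨ht₀.1.le, ht₀.2.le⟩
  have hf : ∀ p ∈ frontier D, p ∈ Metric.ball (t₀, (0 : ℝ)) δ → p.2 = 0 := by
    intro p hp hpb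
    rw [hD, ← Ψ.preimage_frontier, P.frontier_region] at hp
    obtain ⟨j, hj⟩ := mem_iUnion.1 hp
    have hji : j = i := by
      by_contra hji
      exact hball hpb (mem_biUnion (x := j) hji hj)
    subst hji
    obtain ⟨t, -, ht⟩ := hj
    have h1 : Ψ (t, 0) = Ψ p := by
      rw [hΨ (t, 0), ← hline]
      exact ht
    rw [← Ψ.injective h1]
  rcases half_box_subset hDo hcl hδ hf with h | h
  · exact ⟨e, he, δ, hδ, fun t ht s hs => h (mk_mem_prod ht hs)⟩
  · refine ⟨((ContinuousLinearEquiv.refl ℝ ℝ).prodCongr (ContinuousLinearEquiv.neg ℝ)).trans e,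
      ?_, δ, hδ, fun t ht s hs => ?_⟩
    · simpa using he
    · exact h (mk_mem_prod ht (show -s ∈ Ioo (-δ) 0 from ⟨by linarith [hs.2], by linarith [hs.1]⟩))

/-- The size of the half box depends on the point of the edge, so vanishing is first obtained near
each interior point; a locally null set is null. This is what makes traces unique. -/
theorem hasBdryTrace_zero_ae {γ : Plane → ℝ} (h : P.HasBdryTrace 0 γ) (i : Fin P.n) :
    ∀ᵐ t ∂(volume.restrict (Ioo (0 : ℝ) 1)), γ (P.poly.edgePath ℝ i t) = 0 := by
  rw [ae_restrict_iff' measurableSet_Ioo]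
  change volume {t | ¬ (t ∈ Ioo (0 : ℝ) 1 → γ (P.poly.edgePath ℝ i t) = 0)} = 0
  refine measure_null_of_locally_null _ fun t₀ ht₀ => ?_
  simp only [mem_ofPred_eq, Classical.not_imp] at ht₀
  obtain ⟨e, he, δ, hδ, hbox⟩ := P.exists_half_box i ht₀.1
  have hI : MeasurableSet (Metric.ball t₀ δ ∩ Ioo (0 : ℝ) 1) :=
    measurableSet_ball.inter measurableSet_Ioo
  have h0 := HasTrace.ae_eq_zero_of_half_box P.isOpen_region P.isBounded_region (h i) e he hδ hI
    (fun t ht => Ioo_subset_Icc_self ht.2) (fun t ht s hs => hbox t ht.1 s hs)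
  rw [ae_restrict_iff' hI] at h0
  refine ⟨{t | ¬ (t ∈ Metric.ball t₀ δ ∩ Ioo (0 : ℝ) 1 →
    γ (AffineMap.lineMap (P.poly i) (P.poly (finRotate P.n i)) t) = 0)}, ?_, h0⟩
  filter_upwards [self_mem_nhdsWithin, mem_nhdsWithin_of_mem_nhds (Metric.ball_mem_nhds t₀ hδ)]
    with t ht htb
  simp only [Classical.not_imp] at ht ⊢
  exact ⟨⟨htb, ht.1⟩, ht.2⟩

theorem edgeMoment_congr_ae {g h : Plane → ℝ} (i : Fin P.n) (p : Polynomial ℝ)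
    (hgh : ∀ᵐ t ∂(volume.restrict (Ioo (0 : ℝ) 1)),
      g (P.poly.edgePath ℝ i t) = h (P.poly.edgePath ℝ i t)) :
    P.edgeMoment i g p = P.edgeMoment i h p := by
  unfold edgeMoment
  congr 1
  rw [intervalIntegral.integral_of_le zero_le_one, intervalIntegral.integral_of_le zero_le_one,
    ← restrict_Ioo_eq_restrict_Ioc]
  refine integral_congr_ae ?_
  filter_upwards [hgh] with t ht
  rw [ht]

/-! ### Boundary mean values -/

theorem bdryIntegral_comb {g h : Plane → ℝ} (a b : ℝ) (hg : ∀ i, P.EdgeIntegrable i g)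
    (hh : ∀ i, P.EdgeIntegrable i h) :
    P.bdryIntegral (fun x => a * g x + b * h x)
      = a * P.bdryIntegral g + b * P.bdryIntegral h := by
  unfold bdryIntegral
  rw [Finset.mul_sum, Finset.mul_sum, ← Finset.sum_add_distrib]
  exact Finset.sum_congr rfl fun i _ => P.edgeMoment_comb i a b 1 (hg i) (hh i)

/-- The difference of two traces of `w` is a trace of zero, so the trace selected in the definition
of `meanTrace` is immaterial. -/
theorem meanTrace_eq {w : L2 P.region} {γ : Plane → ℝ} (h : P.HasBdryTrace w γ) :
    P.meanTrace w = P.bdryIntegral γ := by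
  have hex : ∃ γ, P.HasBdryTrace w γ := ⟨γ, h⟩
  rw [meanTrace, dif_pos hex]
  refine Finset.sum_congr rfl fun i _ => P.edgeMoment_congr_ae i 1 ?_
  have hd : P.HasBdryTrace (0 : L2 P.region) (fun x => 1 * hex.choose x + (-1) * γ x) := by
    intro i
    have := (hex.choose_spec i).comb P.isOpen_region 1 (-1) (h i)
    rwa [one_smul, neg_one_smul, add_neg_cancel] at this
  filter_upwards [P.hasBdryTrace_zero_ae hd i] with t ht
  linarith

/-- Two continuous representatives agree almost everywhere on the open region, hence everywhere
there, and then on its closure by continuity. -/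
theorem meanVal_eq {v : L2 P.region} {c : Plane → ℝ} (h : HasContRep P.region v c) :
    P.meanVal v = P.bdryIntegral c := by
  have hex : ∃ c, HasContRep P.region v c := ⟨c, h⟩
  rw [meanVal, dif_pos hex]
  have h1 := hex.choose_spec
  have hopen : EqOn hex.choose c P.region := by
    refine Measure.eqOn_open_of_ae_eq (μ := volume) ?_ P.isOpen_region
      (h1.1.mono subset_closure) (h.1.mono subset_closure)
    filter_upwards [h1.2, h.2] with x e1 e2
    rw [← e1, e2]
  have hclos : EqOn hex.choose c (closure P.region) :=
    hopen.of_subset_closure h1.1 h.1 subset_closure Subset.rfl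
  refine Finset.sum_congr rfl fun i _ => P.edgeMoment_congr_ae i 1 ?_
  refine (ae_restrict_mem measurableSet_Ioo).mono fun t ht => hclos ?_
  exact frontier_subset_closure (P.edgeSet_subset_frontier i
    (P.edgePath_mem_edgeSet i (Ioo_subset_Icc_self ht)))

/-- The integral of a constant is that constant times the perimeter, which is positive. -/
theorem eq_zero_of_bdryIntegral_const {c : ℝ} (h : P.bdryIntegral (fun _ => c) = 0) : c = 0 := by
  have e : P.bdryIntegral (fun _ => c) = (∑ i, P.edgeLength i) * c := by
    simp [bdryIntegral, edgeMoment, Finset.sum_mul]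
  rw [e, mul_eq_zero] at h
  refine h.resolve_left (ne_of_gt ?_)
  have : NeZero P.n := ⟨by have := P.three_le; omega⟩
  exact Finset.sum_pos (fun i _ => dist_pos.2 (P.poly_ne_next i)) ⟨0, Finset.mem_univ _⟩

end SimplePolygon

end NCVEM

noncomputable section

namespace NCVEM

/-! ### Polynomials as Sobolev functions -/

/-- The polynomial function on the plane. -/
def polyFun (p : MvPolynomial (Fin 2) ℝ) (x : Plane) : ℝ := MvPolynomial.eval (fun i => x i) p

theorem analyticOnNhd_polyFun (p : MvPolynomial (Fin 2) ℝ) :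
    AnalyticOnNhd ℝ (polyFun p) univ := by
  have h := AnalyticOnNhd.aeval_mvPolynomial (𝕜 := ℝ) (E := Plane) (s := univ)
    (f := fun (x : Plane) (i : Fin 2) => x i)
    (fun i => (EuclideanSpace.proj i : Plane →L[ℝ] ℝ).analyticOnNhd univ) p
  intro x hx
  exact h x hx

theorem contDiff_polyFun (p : MvPolynomial (Fin 2) ℝ) : ContDiff ℝ ∞ (polyFun p) :=
  (analyticOnNhd_polyFun p).contDiff

theorem differentiable_polyFun (p : MvPolynomial (Fin 2) ℝ) : Differentiable ℝ (polyFun p) :=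
  (contDiff_polyFun p).differentiable (by simp)

theorem pderiv_polyFun (i : Fin 2) (p : MvPolynomial (Fin 2) ℝ) :
    pderiv i (polyFun p) = polyFun (MvPolynomial.pderiv i p) := by
  funext x
  induction p using MvPolynomial.induction_on with
  | C a =>
    have : polyFun (MvPolynomial.C a) = fun _ => a := by funext y; simp [polyFun]
    simp [this, pderiv, polyFun]
  | add p q hp hq =>
    have : polyFun (p + q) = polyFun p + polyFun q := by funext y; simp [polyFun]
    unfold pderiv at hp hq ⊢
    rw [this, fderiv_add (differentiable_polyFun p x) (differentiable_polyFun q x)]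
    simp only [add_apply, hp, hq]
    simp [polyFun]
  | mul_X p j hp =>
    have h1 : polyFun (p * MvPolynomial.X j) = polyFun p * fun y : Plane => y j := by
      funext y; simp [polyFun]
    have h2 : HasFDerivAt (fun y : Plane => y j)
        (EuclideanSpace.proj j : Plane →L[ℝ] ℝ) x :=
      (EuclideanSpace.proj j : Plane →L[ℝ] ℝ).hasFDerivAt
    unfold pderiv at hp ⊢
    rw [h1, ((differentiable_polyFun p x).hasFDerivAt.mul h2).fderiv]
    simp only [add_apply, smul_apply, hp]
    simp only [polyFun, Derivation.leibniz, MvPolynomial.pderiv_X, map_add, smul_eq_mul, map_mul,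
      MvPolynomial.eval_X, PiLp.proj_apply, PiLp.single_apply, Pi.single_apply]
    rcases eq_or_ne j i with h | h
    · simp [h]
    · simp [h]

theorem polyFun_eq_const {p : MvPolynomial (Fin 2) ℝ}
    (h : ∀ i, polyFun (MvPolynomial.pderiv i p) = 0) : polyFun p = fun _ => polyFun p 0 := by
  funext x
  refine is_const_of_fderiv_eq_zero (differentiable_polyFun p) (fun y => ?_) x 0
  refine ContinuousLinearMap.coe_injective ?_
  refine (EuclideanSpace.basisFun (Fin 2) ℝ).toBasis.ext fun i => ?_
  have := congrFun (pderiv_polyFun i p) y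
  rw [h i] at this
  simpa [pderiv] using this

namespace SimplePolygon

variable (P : SimplePolygon)

theorem coeFn_polyClass (p : MvPolynomial (Fin 2) ℝ) :
    ∀ᵐ x ∂(volume.restrict P.region), P.polyClass p x = polyFun p x :=
  (P.memLp_poly p).coeFn_toLp

/-- Continuity turns vanishing almost everywhere into vanishing on the open region, and the identity
theorem for analytic functions extends it to the plane. -/
theorem polyFun_eq_zero {p : MvPolynomial (Fin 2) ℝ} (h : P.polyClass p = 0) :
    polyFun p = 0 := by
  have h1 : polyFun p =ᵐ[volume.restrict P.region] (0 : Plane → ℝ) := by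
    filter_upwards [P.coeFn_polyClass p, Lp.coeFn_zero ℝ 2 (volume.restrict P.region)] with x e1 e2
    rw [← e1, h, e2]
  have h2 : EqOn (polyFun p) 0 P.region := Measure.eqOn_open_of_ae_eq h1 P.isOpen_region
    (contDiff_polyFun p).continuous.continuousOn continuousOn_const
  obtain ⟨x, hx⟩ := P.nonempty_region
  exact (analyticOnNhd_polyFun p).eq_of_eventuallyEq (fun _ _ => analyticAt_const) (z₀ := x)
    (h2.eventuallyEq_of_mem (P.isOpen_region.mem_nhds hx))

theorem polyClass_eq_zero {p : MvPolynomial (Fin 2) ℝ} (h : polyFun p = 0) :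
    P.polyClass p = 0 := by
  refine Lp.ext ?_
  filter_upwards [P.coeFn_polyClass p, Lp.coeFn_zero ℝ 2 (volume.restrict P.region)] with x e1 e2
  rw [e1, h, e2]

/-- The test function is supported inside the region, so both integrals extend to the whole plane,
where integration by parts has no boundary term. -/
theorem hasWeakDeriv_polyClass (i : Fin 2) (p : MvPolynomial (Fin 2) ℝ) :
    HasWeakDeriv P.region i (P.polyClass p) (P.polyClass (MvPolynomial.pderiv i p)) := by
  intro φ hφ hc hs
  have hint : ∀ (q : MvPolynomial (Fin 2) ℝ) (ψ : Plane → ℝ), tsupport ψ ⊆ P.region →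
      ∫ x in P.region, P.polyClass q x * ψ x = ∫ x, polyFun q x * ψ x := by
    intro q ψ hψ
    have h0 : ∀ x, x ∉ P.region → polyFun q x * ψ x = 0 := fun x hx => by
      rw [image_eq_zero_of_notMem_tsupport fun h => hx (hψ h), mul_zero]
    rw [← setIntegral_eq_integral_of_forall_compl_eq_zero h0]
    refine integral_congr_ae ?_
    filter_upwards [P.coeFn_polyClass q] with x hx
    rw [hx]
  have hs' : tsupport (pderiv i φ) ⊆ P.region := by
    refine subset_trans (closure_minimal (fun x hx => ?_) isClosed_closure) hs
    by_contra h
    apply hx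
    have : fderiv ℝ φ x = 0 := by
      by_contra h'
      exact h (support_fderiv_subset ℝ h')
    simp [pderiv, this]
  have hi : ∀ (q : MvPolynomial (Fin 2) ℝ) (ψ : Plane → ℝ), Continuous ψ → HasCompactSupport ψ →
      Integrable (fun x => polyFun q x * ψ x) := fun q ψ h1 h2 =>
    ((contDiff_polyFun q).continuous.mul h1).integrable_of_hasCompactSupport h2.mul_left
  rw [hint _ _ hs, hint _ _ hs', ← pderiv_polyFun]
  refine integral_mul_fderiv_eq_neg_fderiv_mul_of_integrable ?_
    (hi _ _ (pderiv_continuous i hφ) (pderiv_hasCompactSupport i hc))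
    (hi _ _ hφ.continuous hc) (fun x _ => differentiable_polyFun p x)
    (fun x _ => (hφ.differentiable (by simp)) x)
  have := hi (MvPolynomial.pderiv i p) φ hφ.continuous hc
  rw [← pderiv_polyFun] at this
  exact this

theorem weakDeriv_polyClass (i : Fin 2) (p : MvPolynomial (Fin 2) ℝ) :
    weakDeriv P.region i (P.polyClass p) = P.polyClass (MvPolynomial.pderiv i p) :=
  (P.hasWeakDeriv_polyClass i p).weakDeriv_eq P.isOpen_region

theorem polyClass_mem_H1 (p : MvPolynomial (Fin 2) ℝ) : P.polyClass p ∈ H1 P.region :=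
  fun i => ⟨_, P.hasWeakDeriv_polyClass i p⟩

theorem polyClass_mem_H2 (p : MvPolynomial (Fin 2) ℝ) : P.polyClass p ∈ H2 P.region :=
  fun i => ⟨_, P.polyClass_mem_H1 _, P.hasWeakDeriv_polyClass i p⟩

theorem hasContRep_polyClass (p : MvPolynomial (Fin 2) ℝ) :
    HasContRep P.region (P.polyClass p) (polyFun p) :=
  ⟨(contDiff_polyFun p).continuous.continuousOn, P.coeFn_polyClass p⟩

/-- The polynomial itself is a constant approximating sequence. -/
theorem hasBdryTrace_polyClass (p : MvPolynomial (Fin 2) ℝ) :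
    P.HasBdryTrace (P.polyClass p) (polyFun p) := by
  have hz : ∀ (q : MvPolynomial (Fin 2) ℝ), eLpNorm (fun x => polyFun q x - P.polyClass q x) 2
      (volume.restrict P.region) = 0 := by
    intro q
    rw [eLpNorm_congr_ae (g := fun _ => (0 : ℝ))]
    · simp
    · filter_upwards [P.coeFn_polyClass q] with x hx
      rw [hx, sub_self]
  intro i
  refine ⟨P.polyClass_mem_H1 p, ?_, fun _ => polyFun p, fun _ => contDiff_polyFun p, ?_, ?_, ?_⟩
  · have hc : Continuous fun t : ℝ =>
        polyFun p (AffineMap.lineMap (P.poly i) (P.poly (finRotate P.n i)) t) :=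
      (contDiff_polyFun p).continuous.comp AffineMap.lineMap_continuous
    obtain ⟨C, hC⟩ := isCompact_Icc.exists_bound_of_continuousOn (s := Icc (0 : ℝ) 1)
      hc.continuousOn
    exact MemLp.of_bound hc.aestronglyMeasurable C
      ((ae_restrict_mem measurableSet_Icc).mono fun x hx => hC x hx)
  · simp only [hz]
    exact tendsto_const_nhds
  · intro j
    simp only [weakDeriv_polyClass, pderiv_polyFun, hz]
    exact tendsto_const_nhds
  · simp

theorem meanVal_polyClass (p : MvPolynomial (Fin 2) ℝ) :
    P.meanVal (P.polyClass p) = P.bdryIntegral (polyFun p) :=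
  P.meanVal_eq (P.hasContRep_polyClass p)

theorem meanTrace_polyClass (p : MvPolynomial (Fin 2) ℝ) :
    P.meanTrace (P.polyClass p) = P.bdryIntegral (polyFun p) :=
  P.meanTrace_eq (P.hasBdryTrace_polyClass p)

/-- A vanishing gradient leaves a constant, which the boundary mean kills. Used once, this gives
uniqueness for the `H¹` projection; used on the first derivatives and then on the polynomial, it
gives uniqueness for the `H²` projection. -/
theorem polyClass_eq_zero_of_bdryIntegral {p : MvPolynomial (Fin 2) ℝ}
    (h : ∀ i, P.polyClass (MvPolynomial.pderiv i p) = 0)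
    (h0 : P.bdryIntegral (polyFun p) = 0) : P.polyClass p = 0 := by
  have hc := polyFun_eq_const fun i => P.polyFun_eq_zero (h i)
  rw [hc] at h0
  have := P.eq_zero_of_bdryIntegral_const h0
  apply P.polyClass_eq_zero
  rw [hc, this]
  rfl

theorem mem_polySpace {k : ℕ} {v : L2 P.region} :
    v ∈ P.polySpace k ↔ ∃ p : MvPolynomial (Fin 2) ℝ, p.totalDegree ≤ k ∧ P.polyClass p = v := by
  simp [polySpace, MvPolynomial.mem_restrictTotalDegree]

end SimplePolygon

/-! ### Abstract projections -/

/-- The projection onto a finite dimensional space that is orthogonal for a semidefinite form, with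
the kernel of the form fixed by finitely many functionals. -/
theorem exists_projection {X Y E ι κ : Type*} [AddCommGroup X] [Module ℝ X]
    [NormedAddCommGroup Y] [InnerProductSpace ℝ Y] [AddCommGroup E] [Module ℝ E]
    [FiniteDimensional ℝ E] [Fintype ι] [Fintype κ] (D : κ → X →ₗ[ℝ] Y) (ℓ : ι → X →ₗ[ℝ] ℝ)
    (j : E →ₗ[ℝ] X) (hdef : ∀ p, (∀ a, D a (j p) = 0) → (∀ i, ℓ i (j p) = 0) → p = 0)
    (hsurj : ∀ c : ι → ℝ, ∃ q, (∀ a, D a (j q) = 0) ∧ ∀ i, ℓ i (j q) = c i) :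
    ∃ Q : X →ₗ[ℝ] E, ∀ x p, ((∀ q, ∑ a, ⟪D a (x - j p), D a (j q)⟫ = 0) ∧
      ∀ i, ℓ i (x - j p) = 0) ↔ p = Q x := by
  -- Adding the squares of the functionals makes the semidefinite form positive definite on `E`. The
  -- desired projection is the `b`-orthogonal one.
  set b : X →ₗ[ℝ] X →ₗ[ℝ] ℝ := (∑ a, (innerₗ Y).compl₁₂ (D a) (D a))
    + ∑ i, (ℓ i).smulRight (ℓ i) with hb
  have hbx : ∀ x y, b x y = (∑ a, ⟪D a x, D a y⟫) + ∑ i, ℓ i x * ℓ i y := by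
    intro x y
    simp [hb, LinearMap.sum_apply]
  have hpos : ∀ x, b x x = 0 → (∀ a, D a x = 0) ∧ ∀ i, ℓ i x = 0 := by
    intro x hx
    rw [hbx] at hx
    have h1 : 0 ≤ ∑ a, ⟪D a x, D a x⟫ := Finset.sum_nonneg fun _ _ => real_inner_self_nonneg
    have h2 : 0 ≤ ∑ i, ℓ i x * ℓ i x := Finset.sum_nonneg fun _ _ => mul_self_nonneg _
    constructor
    · intro a
      have := (Finset.sum_eq_zero_iff_of_nonneg
        (fun a _ => real_inner_self_nonneg (x := D a x))).1 (by linarith) a (Finset.mem_univ _)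
      exact inner_self_eq_zero.1 this
    · intro i
      have := (Finset.sum_eq_zero_iff_of_nonneg
        (fun i _ => mul_self_nonneg (ℓ i x))).1 (by linarith) i (Finset.mem_univ _)
      exact mul_self_eq_zero.1 this
  set A : E →ₗ[ℝ] Module.Dual ℝ E := b.compl₁₂ j j with hA
  have hinj : Function.Injective A := by
    rw [← LinearMap.ker_eq_bot, LinearMap.ker_eq_bot']
    intro p hp
    obtain ⟨h1, h2⟩ := hpos (j p) (by simpa [hA] using LinearMap.congr_fun hp p)
    exact hdef p h1 h2
  set Ae := A.linearEquivOfInjective hinj Subspace.dual_finrank_eq.symm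
  refine ⟨Ae.symm.toLinearMap ∘ₗ b.compl₁₂ LinearMap.id j, fun x p => ?_⟩
  have hiff : p = (Ae.symm.toLinearMap ∘ₗ b.compl₁₂ LinearMap.id j) x ↔
      ∀ q, b (x - j p) (j q) = 0 := by
    rw [LinearMap.comp_apply, LinearEquiv.coe_coe, LinearEquiv.eq_symm_apply]
    constructor
    · intro h q
      have := LinearMap.congr_fun h q
      rw [map_sub, LinearMap.sub_apply, sub_eq_zero]
      exact this.symm
    · intro h
      refine LinearMap.ext fun q => ?_
      have := h q
      rw [map_sub, LinearMap.sub_apply, sub_eq_zero] at this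
      exact this.symm
  rw [hiff]
  constructor
  · rintro ⟨h1, h2⟩ q
    rw [hbx, h1 q]
    simp [h2]
  · intro h
    -- Test with an element of the kernel of `D` whose functionals equal those of the residual: only
    -- the sum of their squares survives. Thus the single `b`-equation contains the constraints, and
    -- the orthogonality follows from them.
    have hℓ : ∀ i, ℓ i (x - j p) = 0 := by
      obtain ⟨q, hq1, hq2⟩ := hsurj fun i => ℓ i (x - j p)
      have := h q
      rw [hbx] at this
      simp only [hq1, hq2, inner_zero_right, Finset.sum_const_zero, zero_add] at this
      intro i
      have := (Finset.sum_eq_zero_iff_of_nonneg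
        (fun i _ => mul_self_nonneg (ℓ i (x - j p)))).1 this i (Finset.mem_univ _)
      exact mul_self_eq_zero.1 this
    refine ⟨fun q => ?_, hℓ⟩
    have := h q
    rw [hbx] at this
    simpa [hℓ] using this

end NCVEM

end

noncomputable section

namespace NCVEM

/-! ### The seminorm projections are linear -/

theorem H2.weakDeriv_mem_H1 {D : Set Plane} (hD : IsOpen D) {v : L2 D} (hv : v ∈ H2 D)
    (i : Fin 2) : weakDeriv D i v ∈ H1 D := by
  obtain ⟨g, hg, h⟩ := hv i
  rwa [h.weakDeriv_eq hD]

/-- A submodule from closure under linear combinations. -/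
def submoduleOfComb {M : Type*} [AddCommGroup M] [Module ℝ M] (p : M → Prop) (h0 : p 0)
    (h : ∀ (a b : ℝ) (u v : M), p u → p v → p (a • u + b • v)) : Submodule ℝ M where
  carrier := {v | p v}
  add_mem' := fun {u v} hu hv => by simpa using h 1 1 u v hu hv
  zero_mem' := h0
  smul_mem' := fun a u hu => by simpa using h a 0 u u hu hu

/-- A linear map from compatibility with linear combinations. -/
def linearMapOfComb {M N : Type*} [AddCommGroup M] [Module ℝ M] [AddCommGroup N]
    [Module ℝ N] (f : M → N) (h : ∀ (a b : ℝ) (u v : M), f (a • u + b • v) = a • f u + b • f v) :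
    M →ₗ[ℝ] N where
  toFun := f
  map_add' u v := by simpa using h 1 1 u v
  map_smul' a u := by simpa using h a 0 u u

namespace SimplePolygon

variable (P : SimplePolygon)

theorem HasBdryTrace.comb {P : SimplePolygon} {u v : L2 P.region} {γ δ : Plane → ℝ} (a b : ℝ)
    (hu : P.HasBdryTrace u γ) (hv : P.HasBdryTrace v δ) :
    P.HasBdryTrace (a • u + b • v) (fun x => a * γ x + b * δ x) :=
  fun i => (hu i).comb P.isOpen_region a b (hv i)

/-- The functions of `H²(K)` that are continuous up to the boundary and whose gradient has a trace
on the boundary. -/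
def traceSpace : Submodule ℝ (L2 P.region) :=
  submoduleOfComb (fun v => v ∈ H2 P.region ∧ (∃ c, HasContRep P.region v c) ∧
      ∀ i, ∃ γ, P.HasBdryTrace (weakDeriv P.region i v) γ)
    ⟨zero_mem _, ⟨_, HasContRep.zero _⟩, fun i => ⟨fun _ => 0, fun j => by
      rw [(HasWeakDeriv.zero _ i).weakDeriv_eq P.isOpen_region]
      exact HasTrace.zero P.isOpen_region _ _⟩⟩
    (by
      rintro a b u v ⟨hu, ⟨c, hc⟩, hγ⟩ ⟨hv, ⟨d, hd⟩, hδ⟩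
      refine ⟨add_mem (Submodule.smul_mem _ a hu) (Submodule.smul_mem _ b hv),
        ⟨_, hc.comb a b hd⟩, fun i => ?_⟩
      rw [weakDeriv_comb P.isOpen_region i a b (H2_le_H1 _ hu) (H2_le_H1 _ hv)]
      obtain ⟨γ, hγ⟩ := hγ i
      obtain ⟨δ, hδ⟩ := hδ i
      exact ⟨_, hγ.comb a b hδ⟩)

/-- First derivatives. -/
def derivL (i : Fin 2) : P.traceSpace →ₗ[ℝ] L2 P.region :=
  linearMapOfComb (fun v => weakDeriv P.region i v) fun a b u v =>
    weakDeriv_comb P.isOpen_region i a b (H2_le_H1 _ u.2.1) (H2_le_H1 _ v.2.1)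

/-- Second derivatives. -/
def deriv2L (a : Fin 2 × Fin 2) : P.traceSpace →ₗ[ℝ] L2 P.region :=
  linearMapOfComb (fun v => weakDeriv P.region a.2 (P.derivL a.1 v)) fun r s u v => by
    rw [map_add, map_smul, map_smul]
    exact weakDeriv_comb P.isOpen_region a.2 r s (H2.weakDeriv_mem_H1 P.isOpen_region u.2.1 _)
      (H2.weakDeriv_mem_H1 P.isOpen_region v.2.1 _)

/-- The boundary mean value. -/
def meanValL : P.traceSpace →ₗ[ℝ] ℝ :=
  linearMapOfComb (fun v => P.meanVal v) fun a b u v => by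
    obtain ⟨c, hc⟩ := u.2.2.1
    obtain ⟨d, hd⟩ := v.2.2.1
    have h := P.meanVal_eq (hc.comb a b hd)
    rw [P.bdryIntegral_comb a b hc.edgeIntegrable hd.edgeIntegrable, ← P.meanVal_eq hc,
      ← P.meanVal_eq hd] at h
    exact h

/-- The boundary mean values of the first derivatives. -/
def meanTraceL (i : Fin 2) : P.traceSpace →ₗ[ℝ] ℝ :=
  linearMapOfComb (fun v => P.meanTrace (P.derivL i v)) fun a b u v => by
    obtain ⟨γ, hγ⟩ := u.2.2.2 i
    obtain ⟨δ, hδ⟩ := v.2.2.2 i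
    rw [map_add, map_smul, map_smul]
    have h := P.meanTrace_eq (hγ.comb a b hδ)
    rw [P.bdryIntegral_comb a b (HasTrace.edgeIntegrable hγ) (HasTrace.edgeIntegrable hδ),
      ← P.meanTrace_eq hγ,
      ← P.meanTrace_eq hδ] at h
    exact h

theorem formM_eq_inner (v w : L2 P.region) : P.formM v w = ⟪v, w⟫ := by
  rw [L2.inner_def]
  refine integral_congr_ae (Eventually.of_forall fun x => ?_)
  simp [mul_comm]

theorem formB_eq (v w : P.traceSpace) :
    P.formB v w = ∑ i, ⟪P.derivL i v, P.derivL i w⟫ := by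
  simp only [formB, formM_eq_inner]
  rfl

theorem formA_eq (v w : P.traceSpace) :
    P.formA v w = ∑ a, ⟪P.deriv2L a v, P.deriv2L a w⟫ := by
  simp only [formA, formB, formM_eq_inner, Fintype.sum_prod_type]
  rfl

theorem polySpace_le_traceSpace (k : ℕ) : P.polySpace k ≤ P.traceSpace := by
  rintro _ hv
  obtain ⟨p, -, rfl⟩ := P.mem_polySpace.1 hv
  refine ⟨P.polyClass_mem_H2 p, ⟨_, P.hasContRep_polyClass p⟩, fun i => ?_⟩
  rw [weakDeriv_polyClass]
  exact ⟨_, P.hasBdryTrace_polyClass _⟩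

/-- Polynomials as functions with traces. -/
def polyL (k : ℕ) : P.polySpace k →ₗ[ℝ] P.traceSpace :=
  Submodule.inclusion (P.polySpace_le_traceSpace k)

theorem bdryIntegral_const (c : ℝ) :
    P.bdryIntegral (fun _ => c) = P.bdryIntegral (fun _ => 1) * c := by
  have h := P.bdryIntegral_comb (g := fun _ => (1 : ℝ)) (h := fun _ => (0 : ℝ)) c 0
    (fun i => intervalIntegrable_const) (fun i => intervalIntegrable_const)
  simp only [mul_one, mul_zero, add_zero, zero_mul] at h
  rw [h, mul_comm]

theorem exists_const_bdryIntegral (r : ℝ) : ∃ c : ℝ, P.bdryIntegral (fun _ => c) = r := by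
  have h : P.bdryIntegral (fun _ => 1) ≠ 0 := fun h =>
    one_ne_zero (P.eq_zero_of_bdryIntegral_const h)
  exact ⟨r / P.bdryIntegral (fun _ => 1), by rw [bdryIntegral_const, mul_div_cancel₀ _ h]⟩

theorem polyFun_C (c : ℝ) : polyFun (MvPolynomial.C c) = fun _ => c := by
  funext x
  simp [polyFun]

/-- The kernel of the `H¹` seminorm on polynomials is the constants, and the boundary mean is a
coordinate on it. Hence the defining equations have exactly one solution, depending linearly on the
function. -/
theorem exists_projGrad_eq_linear (k : ℕ) :
    ∃ Q : P.traceSpace →ₗ[ℝ] P.polySpace k, ∀ v : P.traceSpace, P.projGrad k v = Q v := by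
  obtain ⟨Q, hQ⟩ := exists_projection P.derivL (fun _ : Unit => P.meanValL) (P.polyL k) (by
    rintro ⟨_, hp⟩ h1 h2
    obtain ⟨p, -, rfl⟩ := P.mem_polySpace.1 hp
    refine Subtype.ext (P.polyClass_eq_zero_of_bdryIntegral (fun i => ?_) ?_)
    · rw [← weakDeriv_polyClass]
      exact h1 i
    · rw [← meanVal_polyClass]
      exact h2 ()) (by
    intro c
    obtain ⟨r, hr⟩ := P.exists_const_bdryIntegral (c ())
    refine ⟨⟨P.polyClass (MvPolynomial.C r), P.mem_polySpace.2 ⟨_, by simp, rfl⟩⟩,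
      fun i => ?_, fun _ => ?_⟩
    · refine (P.weakDeriv_polyClass i _).trans ?_
      simp
    · refine (P.meanVal_polyClass _).trans ?_
      rw [polyFun_C, hr])
  refine ⟨Q, fun v => ?_⟩
  have hiff : ∀ p, P.IsProjGrad k v p ↔ p = Q v := by
    intro p
    rw [← hQ v p]
    refine and_congr ⟨fun h q => ?_, fun h q hq => ?_⟩ ⟨fun h _ => h, fun h => h ()⟩
    · rw [← formB_eq]
      exact h q q.2
    · have := h ⟨q, hq⟩
      rw [← formB_eq] at this
      exact this
  have hex : ∃ p, P.IsProjGrad k v p := ⟨_, (hiff _).2 rfl⟩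
  rw [projGrad, dif_pos hex]
  exact (hiff _).1 hex.choose_spec

/-- Here the kernel is the affine functions, available because `1 ≤ k`. Their three coordinates are
the boundary mean (index `none`) and the means of the two derivatives (index `some i`). -/
theorem exists_projHess_eq_linear {k : ℕ} (hk : 1 ≤ k) :
    ∃ Q : P.traceSpace →ₗ[ℝ] P.polySpace k, ∀ v : P.traceSpace, P.projHess k v = Q v := by
  obtain ⟨Q, hQ⟩ := exists_projection P.deriv2L
    (fun o : Option (Fin 2) => o.elim P.meanValL P.meanTraceL) (P.polyL k) (by
    rintro ⟨_, hp⟩ h1 h2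
    obtain ⟨p, -, rfl⟩ := P.mem_polySpace.1 hp
    refine Subtype.ext (P.polyClass_eq_zero_of_bdryIntegral (fun i => ?_) ?_)
    · refine P.polyClass_eq_zero_of_bdryIntegral (fun j => ?_) ?_
      · rw [← weakDeriv_polyClass, ← weakDeriv_polyClass]
        exact h1 (i, j)
      · rw [← meanTrace_polyClass, ← weakDeriv_polyClass]
        exact h2 (some i)
    · rw [← meanVal_polyClass]
      exact h2 none) (by
    intro c
    obtain ⟨r0, hr0⟩ := P.exists_const_bdryIntegral (c (some 0))
    obtain ⟨r1, hr1⟩ := P.exists_const_bdryIntegral (c (some 1))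
    set p : MvPolynomial (Fin 2) ℝ := MvPolynomial.C r0 * MvPolynomial.X 0
      + MvPolynomial.C r1 * MvPolynomial.X 1 with hp
    -- The slopes are already fixed by the gradient means; the constant term corrects the mean of
    -- the linear part without changing the gradient.
    obtain ⟨r, hr⟩ := P.exists_const_bdryIntegral (c none - P.bdryIntegral (polyFun p))
    set q : MvPolynomial (Fin 2) ℝ := p + MvPolynomial.C r with hq
    have hdeg : q.totalDegree ≤ k := by
      have hX : ∀ (s : ℝ) (i : Fin 2),
          (MvPolynomial.C s * MvPolynomial.X i : MvPolynomial (Fin 2) ℝ).totalDegree ≤ 1 := by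
        intro s i
        refine (MvPolynomial.totalDegree_mul _ _).trans ?_
        simp
      refine le_trans ?_ hk
      refine (MvPolynomial.totalDegree_add _ _).trans (max_le ?_ (by simp))
      exact (MvPolynomial.totalDegree_add _ _).trans (max_le (hX _ _) (hX _ _))
    have hd0 : MvPolynomial.pderiv 0 q = MvPolynomial.C r0 := by
      simp [hq, hp, MvPolynomial.pderiv_X]
    have hd1 : MvPolynomial.pderiv 1 q = MvPolynomial.C r1 := by
      simp [hq, hp, MvPolynomial.pderiv_X]
    refine ⟨⟨P.polyClass q, P.mem_polySpace.2 ⟨_, hdeg, rfl⟩⟩, ?_, ?_⟩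
    · rintro ⟨i, j⟩
      show weakDeriv P.region j (weakDeriv P.region i (P.polyClass q)) = 0
      rw [weakDeriv_polyClass, weakDeriv_polyClass]
      have : ∃ s, MvPolynomial.pderiv i q = MvPolynomial.C s := by
        fin_cases i
        exacts [⟨_, hd0⟩, ⟨_, hd1⟩]
      obtain ⟨s, hs⟩ := this
      simp [hs]
    · rintro (_ | i)
      · refine (P.meanVal_polyClass _).trans ?_
        have h1 : polyFun q = fun x => 1 * polyFun p x + 1 * (fun _ => r) x := by
          funext x
          simp [hq, polyFun]
        rw [h1, P.bdryIntegral_comb (h := fun _ => r) 1 1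
          (P.hasContRep_polyClass p).edgeIntegrable (fun i => intervalIntegrable_const), hr]
        ring
      · show P.meanTrace (weakDeriv P.region i (P.polyClass q)) = _
        rw [weakDeriv_polyClass, meanTrace_polyClass]
        fin_cases i
        · exact (congrArg (fun s => P.bdryIntegral (polyFun s)) hd0).trans
            (by rw [polyFun_C, hr0]; rfl)
        · exact (congrArg (fun s => P.bdryIntegral (polyFun s)) hd1).trans
            (by rw [polyFun_C, hr1]; rfl))
  refine ⟨Q, fun v => ?_⟩
  have hiff : ∀ p, P.IsProjHess k v p ↔ p = Q v := by
    intro p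
    rw [← hQ v p]
    refine and_congr ⟨fun h q => ?_, fun h q hq => ?_⟩ ⟨fun h o => ?_, fun h => ⟨h none, fun i =>
      h (some i)⟩⟩
    · rw [← formA_eq]
      exact h q q.2
    · have := h ⟨q, hq⟩
      rw [← formA_eq] at this
      exact this
    · rcases o with _ | i
      exacts [h.1, h.2 i]
  have hex : ∃ p, P.IsProjHess k v p := ⟨_, (hiff _).2 rfl⟩
  rw [projHess, dif_pos hex]
  exact (hiff _).1 hex.choose_spec

end SimplePolygon

/-! ### Sums of semidefinite forms and semilinear equations -/

/-- The common shape of `M_h`, `A_h` and `B_h`: the maps `D K a` yield the polynomial part as inner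
products, and `R K` is the map `I - Π` that feeds the stabilization. -/
theorem exists_bilinear {W ι κ : Type*} {Y Z : ι → Type*} [AddCommGroup W] [Module ℝ W]
    [Fintype ι] [Fintype κ] [∀ K, NormedAddCommGroup (Y K)] [∀ K, InnerProductSpace ℝ (Y K)]
    [∀ K, AddCommGroup (Z K)] [∀ K, Module ℝ (Z K)] (D : ∀ K, κ → W →ₗ[ℝ] Y K)
    (S : ∀ K, Z K →ₗ[ℝ] Z K →ₗ[ℝ] ℝ) (hS : ∀ K z, 0 ≤ S K z z) (R : ∀ K, W →ₗ[ℝ] Z K) :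
    ∃ G : W →ₗ[ℝ] W →ₗ[ℝ] ℝ,
      (∀ u v, G u v = ∑ K, ((∑ a, ⟪D K a u, D K a v⟫) + S K (R K u) (R K v))) ∧
      ∀ u, 0 ≤ G u u := by
  have h : ∀ u v, (∑ K, ((∑ a, (innerₗ (Y K)).compl₁₂ (D K a) (D K a))
      + (S K).compl₁₂ (R K) (R K))) u v
        = ∑ K, ((∑ a, ⟪D K a u, D K a v⟫) + S K (R K u) (R K v)) := by
    intro u v
    simp [LinearMap.sum_apply]
  refine ⟨_, h, fun u => ?_⟩
  rw [h]
  exact Finset.sum_nonneg fun K _ =>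
    add_nonneg (Finset.sum_nonneg fun _ _ => real_inner_self_nonneg) (hS K _)

/-- A coercive linear equation with a Lipschitz right hand side has a unique solution when the
Lipschitz constant is smaller than the coercivity constant. -/
theorem existsUnique_semilinear {W : Type*} [NormedAddCommGroup W] [NormedSpace ℝ W]
    [FiniteDimensional ℝ W] (G : W →ₗ[ℝ] W →ₗ[ℝ] ℝ) (F : W → W →ₗ[ℝ] ℝ) {c L : ℝ} (hL : 0 ≤ L)
    (hLc : L < c) (hG : ∀ v, c * ‖v‖ ^ 2 ≤ G v v)
    (hF : ∀ u w v, |F u v - F w v| ≤ L * ‖u - w‖ * ‖v‖) : ∃! u, ∀ v, G u v = F u v := by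
  have hc : 0 < c := hL.trans_lt hLc
  have hinj : Function.Injective G := by
    rw [← LinearMap.ker_eq_bot, LinearMap.ker_eq_bot']
    intro v hv
    have h := hG v
    rw [hv, LinearMap.zero_apply] at h
    have : ‖v‖ ^ 2 ≤ 0 := by
      by_contra h'
      exact absurd h (not_le.2 (mul_pos hc (not_le.1 h')))
    exact norm_eq_zero.1 (pow_eq_zero_iff two_ne_zero |>.1 (le_antisymm this (sq_nonneg _)))
  let Ge : W ≃ₗ[ℝ] Module.Dual ℝ W :=
    G.linearEquivOfInjective hinj Subspace.dual_finrank_eq.symm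
  have hGe : ∀ u, Ge u = G u := fun _ => rfl
  -- Coercivity makes `G` injective, hence an isomorphism onto the dual in finite dimension.
  -- Solutions are the fixed points of `G⁻¹ ∘ F`.
  let S : W → W := fun u => Ge.symm (F u)
  have hS : ∀ u, G (S u) = F u := fun u => by rw [← hGe, LinearEquiv.apply_symm_apply]
  have hfix : ∀ u, (∀ v, G u v = F u v) ↔ S u = u := by
    intro u
    rw [LinearEquiv.symm_apply_eq, hGe, eq_comm]
    exact (LinearMap.ext_iff).symm
  have hcontr : ContractingWith (Real.toNNReal (L / c)) S := by
    refine ⟨?_, LipschitzWith.of_dist_le_mul fun u w => ?_⟩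
    · rw [Real.toNNReal_lt_one]
      exact (div_lt_one hc).2 hLc
    · rw [dist_eq_norm, dist_eq_norm, Real.coe_toNNReal _ (div_nonneg hL hc.le)]
      set e := S u - S w with he
      -- Coercivity tested on the difference of two images; cancelling one factor `‖e‖` gives the
      -- contraction factor `L / c`.
      have h1 : c * ‖e‖ ^ 2 ≤ L * ‖u - w‖ * ‖e‖ := by
        refine (hG e).trans ((le_abs_self _).trans ?_)
        have h2 : G e e = F u e - F w e := by
          rw [← LinearMap.sub_apply, ← hS, ← hS, ← map_sub]
        rw [h2]
        exact hF u w e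
      rcases (norm_nonneg e).eq_or_lt with h0 | h0
      · rw [← h0]
        positivity
      · rw [div_mul_eq_mul_div, le_div_iff₀ hc]
        refine le_of_mul_le_mul_right ?_ h0
        calc ‖e‖ * c * ‖e‖ = c * ‖e‖ ^ 2 := by ring
          _ ≤ _ := h1
  have : CompleteSpace W := FiniteDimensional.complete ℝ W
  refine ⟨ContractingWith.fixedPoint S hcontr, (hfix _).2 hcontr.fixedPoint_isFixedPt,
    fun y hy => hcontr.fixedPoint_unique ((hfix y).1 hy)⟩

end NCVEM

end

noncomputable section

namespace NCVEM

variable {Ω : Set Plane} {T : PolyMesh Ω} {k : ℕ}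

/-! ### The discrete forms are bilinear and semidefinite -/

namespace LocalSpaces

variable (W : LocalSpaces T k) (bc : BC)

/-- The restriction to an element as a linear map to the local space. -/
def locRes (K : Fin T.card) : W.global bc →ₗ[ℝ] W.loc K :=
  LinearMap.codRestrict _ (T.res K ∘ₗ (W.global bc).subtype) fun v => v.2.2 K

/-- The restriction to an element as a linear map to the functions with traces. -/
def traceRes (K : Fin T.card) : W.global bc →ₗ[ℝ] (T.elem K).traceSpace :=
  LinearMap.codRestrict _ (T.res K ∘ₗ (W.global bc).subtype) fun v => by
    obtain ⟨h2, c, γ, hc, hγ, -⟩ := v.2.1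
    exact ⟨h2 K, ⟨_, hc K⟩, fun i => ⟨_, hγ K i⟩⟩

variable {W} in
theorem IsStabilization.nonneg {a : ∀ K, L2 (T.elem K).region → L2 (T.elem K).region → ℝ}
    {π : ∀ K, L2 (T.elem K).region → (T.elem K).polySpace k}
    {S : ∀ K, W.loc K →ₗ[ℝ] W.loc K →ₗ[ℝ] ℝ} (h : W.IsStabilization a π S) (K : Fin T.card)
    (v : W.loc K) : 0 ≤ S K v v := by
  rcases eq_or_ne v 0 with rfl | hv
  · simp
  · exact (h.pos K v hv).le

end LocalSpaces

namespace VEM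

variable (V : VEM T k) (bc : BC)

/-- Restrictions of global functions carry a continuous representative and gradient traces, so
`projHess` acts on them as a linear map. Semidefiniteness uses only the sign of the stabilization.
-/
theorem exists_formA_eq (hk : 1 ≤ k) : ∃ G : V.global bc →ₗ[ℝ] V.global bc →ₗ[ℝ] ℝ,
    (∀ u v, V.formA bc u v = G u v) ∧ ∀ u, 0 ≤ G u u := by
  choose Q hQ using fun K => (T.elem K).exists_projHess_eq_linear hk
  obtain ⟨G, hG, hG0⟩ := exists_bilinear
    (fun K a => (T.elem K).deriv2L a ∘ₗ (T.elem K).polyL k ∘ₗ Q K ∘ₗ V.traceRes bc K)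
    V.Shess V.stabHess.nonneg
    (fun K => V.locRes bc K - Submodule.inclusion (V.poly_le K) ∘ₗ Q K ∘ₗ V.traceRes bc K)
  refine ⟨G, fun u v => ?_, hG0⟩
  rw [hG]
  refine Finset.sum_congr rfl fun K _ => ?_
  have hp : ∀ w, (T.elem K).projHess k (V.res bc K w : L2 (T.elem K).region)
      = Q K (V.traceRes bc K w) := fun w => hQ K (V.traceRes bc K w)
  simp only [locA, hp]
  congr 1
  exact (T.elem K).formA_eq ((T.elem K).polyL k (Q K (V.traceRes bc K u)))
    ((T.elem K).polyL k (Q K (V.traceRes bc K v)))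

/-- Two projections enter: the `L²` projection of the gradient in the consistency part, and
`projGrad` in the stabilization. -/
theorem exists_formB_eq : ∃ G : V.global bc →ₗ[ℝ] V.global bc →ₗ[ℝ] ℝ,
    (∀ u v, V.formB bc u v = G u v) ∧ ∀ u, 0 ≤ G u u := by
  choose Q hQ using fun K => (T.elem K).exists_projGrad_eq_linear k
  obtain ⟨G, hG, hG0⟩ := exists_bilinear
    (fun K i => ((T.elem K).polySpace (k - 1)).subtype ∘ₗ
      ((T.elem K).polySpace (k - 1)).orthogonalProjectionOnto.toLinearMap ∘ₗ
      (T.elem K).derivL i ∘ₗ V.traceRes bc K)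
    V.Sgrad V.stabGrad.nonneg
    (fun K => V.locRes bc K - Submodule.inclusion (V.poly_le K) ∘ₗ Q K ∘ₗ V.traceRes bc K)
  refine ⟨G, fun u v => ?_, hG0⟩
  rw [hG]
  refine Finset.sum_congr rfl fun K _ => ?_
  have hp : ∀ w, (T.elem K).projGrad k (V.res bc K w : L2 (T.elem K).region)
      = Q K (V.traceRes bc K w) := fun w => hQ K (V.traceRes bc K w)
  simp only [locB, hp, SimplePolygon.formM_eq_inner]
  rfl

theorem exists_formM_eq : ∃ G : V.global bc →ₗ[ℝ] V.global bc →ₗ[ℝ] ℝ,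
    (∀ u v, V.formM bc u v = G u v) ∧ ∀ u, 0 ≤ G u u := by
  let Q : ∀ K, V.global bc →ₗ[ℝ] (T.elem K).polySpace k := fun K =>
    ((T.elem K).polySpace k).orthogonalProjectionOnto.toLinearMap ∘ₗ
      (V.loc K).subtype ∘ₗ V.locRes bc K
  obtain ⟨G, hG, hG0⟩ := exists_bilinear
    (fun K (_ : Unit) => ((T.elem K).polySpace k).subtype ∘ₗ Q K) V.S0 V.stab0.nonneg
    (fun K => V.locRes bc K - Submodule.inclusion (V.poly_le K) ∘ₗ Q K)
  refine ⟨G, fun u v => ?_, hG0⟩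
  rw [hG]
  refine Finset.sum_congr rfl fun K _ => ?_
  simp only [locM, SimplePolygon.formM_eq_inner, Finset.univ_unique, Finset.sum_singleton]
  rfl

theorem formM_symm (u v : V.global bc) : V.formM bc u v = V.formM bc v u := by
  refine Finset.sum_congr rfl fun K _ => ?_
  rw [locM, locM, SimplePolygon.formM_eq_inner, SimplePolygon.formM_eq_inner, real_inner_comm,
    V.stab0.symm]

end VEM

/-! ### The norm is assembled from the elements -/

theorem coeFn_restrictL {D Ω : Set Plane} (h : D ⊆ Ω) (v : L2 Ω) :
    ∀ᵐ x ∂(volume.restrict D), restrictL h v x = v x :=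
  MemLp.coeFn_toLp ((Lp.memLp v).mono_measure (Measure.restrict_mono_set volume h))

theorem norm_sq_eq_integral {D : Set Plane} (v : L2 D) : ‖v‖ ^ 2 = ∫ x in D, v x * v x := by
  rw [← real_inner_self_eq_norm_sq, L2.inner_def]
  simp [sq]

/-- Each edge lies on a line, a proper affine subspace of the plane. -/
theorem SimplePolygon.volume_frontier (P : SimplePolygon) : volume (frontier P.region) = 0 := by
  rw [P.frontier_region, Polygon.boundary]
  refine measure_iUnion_null fun i => ?_
  refine measure_mono_null (t := (line[ℝ, P.poly i, P.poly (finRotate P.n i)] : Set Plane)) ?_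
    (Measure.addHaar_affineSubspace _ _ fun h => ?_)
  · rintro _ ⟨t, -, rfl⟩
    exact AffineMap.lineMap_mem_affineSpan_pair t _ _
  · have h2 : vectorSpan ℝ {P.poly i, P.poly (finRotate P.n i)} = (⊤ : Submodule ℝ Plane) := by
      rw [← direction_affineSpan, h, AffineSubspace.direction_top]
    have h3 := collinear_pair ℝ (P.poly i) (P.poly (finRotate P.n i))
    rw [collinear_iff_finrank_le_one, h2, finrank_top] at h3
    simp at h3

/-- A point of `Ω` outside every open element lies in some closed element, hence on its frontier,
which is null. -/
theorem PolyMesh.ae_eq_iUnion (T : PolyMesh Ω) :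
    Ω =ᵐ[volume] ⋃ K, (T.elem K).region := by
  have hsub : (⋃ K, (T.elem K).region) ⊆ Ω := iUnion_subset T.subset
  refine (ae_eq_set.2 ⟨?_, by rw [sdiff_eq_empty.2 hsub, measure_empty]⟩)
  refine measure_mono_null (t := ⋃ K, frontier (T.elem K).region) ?_
    (measure_iUnion_null fun K => (T.elem K).volume_frontier)
  rintro x ⟨hx, hxn⟩
  have := subset_closure hx
  rw [T.cover] at this
  obtain ⟨K, hK⟩ := mem_iUnion.1 this
  refine mem_iUnion.2 ⟨K, ?_⟩
  rw [(T.elem K).isOpen_region.frontier_eq]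
  exact ⟨hK, fun h => hxn (mem_iUnion.2 ⟨K, h⟩)⟩

theorem PolyMesh.norm_sq_eq_sum (T : PolyMesh Ω) (v : L2 Ω) :
    ‖v‖ ^ 2 = ∑ K, ‖T.res K v‖ ^ 2 := by
  have hint : Integrable (fun x => v x * v x) (volume.restrict Ω) :=
    (Lp.memLp v).integrable_mul (Lp.memLp v)
  rw [norm_sq_eq_integral, setIntegral_congr_set T.ae_eq_iUnion,
    integral_iUnion_fintype (fun K => (T.elem K).isOpen_region.measurableSet) T.disjoint
      (fun K => hint.mono_measure (Measure.restrict_mono_set _ (T.subset K)))]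
  refine Finset.sum_congr rfl fun K _ => ?_
  rw [norm_sq_eq_integral]
  refine integral_congr_ae ?_
  filter_upwards [coeFn_restrictL (T.subset K) v] with x hx
  rw [PolyMesh.res, hx]

theorem PolyMesh.sum_norm_mul_le (T : PolyMesh Ω) (u v : L2 Ω) :
    ∑ K, ‖T.res K u‖ * ‖T.res K v‖ ≤ ‖u‖ * ‖v‖ := by
  refine le_of_sq_le_sq ?_ (by positivity)
  rw [mul_pow, T.norm_sq_eq_sum u, T.norm_sq_eq_sum v]
  exact Finset.sum_mul_sq_le_sq_mul_sq _ _ _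

/-! ### Finite dimension and the mass constants -/

namespace VEM

variable (V : VEM T k) (bc : BC)

/-- A global function is determined by its restrictions, because their squared norms add up; so the
space embeds in the product of the local ones. -/
theorem finiteDimensional_global : FiniteDimensional ℝ (V.global bc) := by
  have := V.finiteDimensional
  refine FiniteDimensional.of_injective (LinearMap.pi fun K => V.locRes bc K) ?_
  rw [← LinearMap.ker_eq_bot, LinearMap.ker_eq_bot']
  intro v hv
  have h : ∀ K, T.res K (v : L2 Ω) = 0 := fun K => congrArg Subtype.val (congrFun hv K)
  have hn := T.norm_sq_eq_sum (v : L2 Ω)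
  simp only [h, norm_zero, ne_eq, OfNat.ofNat_ne_zero, not_false_eq_true, zero_pow,
    Finset.sum_const_zero] at hn
  exact Subtype.ext (norm_eq_zero.1 (pow_eq_zero_iff two_ne_zero |>.1 hn))

/-- Split `v` orthogonally into its polynomial projection and a remainder in the kernel of the
projection. The first part enters with constant `1`, the second with the stabilization constants;
hence `min 1 c` and `max 1 C`, both independent of the element. -/
theorem exists_locM_bounds : ∃ c C : ℝ, 0 < c ∧ 0 < C ∧ ∀ K (v : V.loc K),
    c * ‖v‖ ^ 2 ≤ V.locM K v v ∧ V.locM K v v ≤ C * ‖v‖ ^ 2 := by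
  obtain ⟨c, C, hc, hC, h⟩ := V.stab0.equiv
  refine ⟨min 1 c, max 1 C, lt_min one_pos hc, lt_max_of_lt_left one_pos, fun K v => ?_⟩
  set p := (T.elem K).projL2 k v with hp
  set w : V.loc K := v - V.ofPoly K p with hw
  have hwc : (w : L2 (T.elem K).region) = v - p := rfl
  have hpw : (T.elem K).projL2 k (w : L2 (T.elem K).region) = 0 := by
    rw [hwc, SimplePolygon.projL2, map_sub, Submodule.orthogonalProjectionOnto_mem_subspace_eq_self]
    exact sub_self _
  have hort : ⟪(p : L2 (T.elem K).region), (w : L2 (T.elem K).region)⟫ = 0 :=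
    ((Submodule.orthogonalProjectionOnto_eq_zero_iff).1 hpw) _ p.2
  have hsum : ‖v‖ ^ 2 = ‖p‖ ^ 2 + ‖w‖ ^ 2 := by
    have : (v : L2 (T.elem K).region) = p + w := by rw [hwc]; abel
    have h2 := norm_add_sq_eq_norm_sq_add_norm_sq_real hort
    rw [← this] at h2
    rw [sq, sq, sq]
    exact h2
  obtain ⟨h1, h2⟩ := h K w hpw
  rw [SimplePolygon.formM_eq_inner, real_inner_self_eq_norm_sq] at h1 h2
  have hM : V.locM K v v = ‖p‖ ^ 2 + V.S0 K w w := by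
    rw [locM, SimplePolygon.formM_eq_inner, real_inner_self_eq_norm_sq]
    rfl
  have hwn : ‖(w : L2 (T.elem K).region)‖ = ‖w‖ := rfl
  rw [hwn] at h1 h2
  rw [hM, hsum]
  constructor
  · nlinarith [mul_le_mul_of_nonneg_right (min_le_left 1 c) (sq_nonneg ‖p‖),
      mul_le_mul_of_nonneg_right (min_le_right 1 c) (sq_nonneg ‖w‖)]
  · nlinarith [mul_le_mul_of_nonneg_right (le_max_left 1 C) (sq_nonneg ‖p‖),
      mul_le_mul_of_nonneg_right (le_max_right 1 C) (sq_nonneg ‖w‖)]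

/-- The local bounds add up to bounds on `M_h(v, v)`; Cauchy–Schwarz for the semidefinite symmetric
form `M_h` then bounds the mixed terms with the same upper constant. -/
theorem exists_massConstants : ∃ Clow Cup : ℝ, V.MassConstants bc Clow Cup := by
  obtain ⟨c, C, hc, hC, h⟩ := V.exists_locM_bounds
  have hnorm : ∀ v : V.global bc, ‖v‖ ^ 2 = ∑ K, ‖V.res bc K v‖ ^ 2 := fun v =>
    T.norm_sq_eq_sum (v : L2 Ω)
  have hup : ∀ v, V.formM bc v v ≤ C * ‖v‖ ^ 2 := fun v => by
    rw [hnorm, Finset.mul_sum]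
    exact Finset.sum_le_sum fun K _ => (h K _).2
  obtain ⟨G, hG, hG0⟩ := V.exists_formM_eq bc
  refine ⟨c, C, hc, hC, fun v w => ?_, fun v => ?_⟩
  · refine abs_le_of_sq_le_sq ?_ (by positivity)
    have hcs := LinearMap.BilinForm.apply_mul_apply_le_of_forall_zero_le G hG0 v w
    rw [← hG, ← hG, ← hG, ← hG, V.formM_symm bc w v, ← sq] at hcs
    calc V.formM bc v w ^ 2 ≤ V.formM bc v v * V.formM bc w w := hcs
      _ ≤ (C * ‖v‖ ^ 2) * (C * ‖w‖ ^ 2) :=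
        mul_le_mul (hup v) (hup w) (by rw [hG]; exact hG0 w) (by positivity)
      _ = _ := by ring
  · rw [hnorm, Finset.mul_sum]
    exact Finset.sum_le_sum fun K _ => (h K _).1

end VEM

/-! ### The nonlinear term -/

/-- `|f(u) - f(0)| ≤ L|u|`, and constants are square integrable on a bounded set. So `toL2` never
takes its default value zero in `F_h`. -/
theorem memLp_lipschitz_comp {D : Set Plane} (hD : Bornology.IsBounded D) {f : ℝ → ℝ} {L : ℝ}
    (hL : 0 ≤ L) (hf : ∀ x y, |f x - f y| ≤ L * |x - y|) (u : L2 D) :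
    MemLp (fun x => f (u x)) 2 (volume.restrict D) := by
  have : IsFiniteMeasure (volume.restrict D) := ⟨by simpa using hD.measure_lt_top⟩
  have hlip : LipschitzWith (Real.toNNReal L) f := LipschitzWith.of_dist_le_mul fun x y => by
    rw [Real.coe_toNNReal _ hL]
    exact hf x y
  have h1 : MemLp (fun x => f (u x) - f 0) 2 (volume.restrict D) := by
    refine (Lp.memLp u).of_le_mul (c := L)
      ((hlip.continuous.comp_aestronglyMeasurable (Lp.aestronglyMeasurable u)).sub
        aestronglyMeasurable_const) (Eventually.of_forall fun x => ?_)
    simpa using hf (u x) 0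
  convert h1.add (memLp_const (f 0)) using 1
  funext x
  simp

theorem norm_toL2_lipschitz_sub_le {D : Set Plane} (hD : Bornology.IsBounded D) {f : ℝ → ℝ}
    {L : ℝ} (hL : 0 ≤ L) (hf : ∀ x y, |f x - f y| ≤ L * |x - y|) (u w : L2 D) :
    ‖toL2 D (fun x => f (u x)) - toL2 D (fun x => f (w x))‖ ≤ L * ‖u - w‖ := by
  have hu := memLp_lipschitz_comp hD hL hf u
  have hw := memLp_lipschitz_comp hD hL hf w
  rw [toL2, toL2, dif_pos hu, dif_pos hw]
  refine Lp.norm_le_mul_norm_of_ae_le_mul ?_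
  filter_upwards [Lp.coeFn_sub (hu.toLp _) (hw.toLp _), Lp.coeFn_sub u w, hu.coeFn_toLp,
    hw.coeFn_toLp] with x h1 h2 h3 h4
  rw [h1, h2, Pi.sub_apply, Pi.sub_apply, h3, h4]
  exact hf _ _

theorem SimplePolygon.norm_projL2_sub_le (P : SimplePolygon) (ℓ : ℕ) (u v : L2 P.region) :
    ‖(P.projL2 ℓ u : L2 P.region) - P.projL2 ℓ v‖ ≤ ‖u - v‖ := by
  have h : (P.projL2 ℓ u : L2 P.region) - P.projL2 ℓ v = P.projL2 ℓ (u - v) := by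
    simp only [projL2, map_sub]
    rfl
  rw [h]
  exact (P.polySpace ℓ).norm_orthogonalProjectionOnto_apply_le _

namespace VEM

variable (V : VEM T k) (bc : BC)

/-- The projections inside and outside `f` are nonexpansive in `L²`, so the constant of `f` survives
on each element; Cauchy–Schwarz over the elements keeps it globally. -/
theorem exists_formF_eq {f : ℝ → ℝ} {L : ℝ} (hL : 0 ≤ L)
    (hf : ∀ x y, |f x - f y| ≤ L * |x - y|) :
    ∃ F : V.global bc → V.global bc →ₗ[ℝ] ℝ, (∀ u v, V.formF bc f u v = F u v) ∧
      ∀ u w v, |F u v - F w v| ≤ L * ‖u - w‖ * ‖v‖ := by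
  let g : ∀ K, V.global bc → L2 (T.elem K).region := fun K u =>
    (T.elem K).projL2 k (toL2 (T.elem K).region
      (fun x => f (((T.elem K).projL2 k (T.res K u) : L2 (T.elem K).region) x)))
  have hg : ∀ K u w, ‖g K u - g K w‖ ≤ L * ‖T.res K (u - w : V.global bc)‖ := by
    intro K u w
    refine ((T.elem K).norm_projL2_sub_le k _ _).trans ?_
    refine (norm_toL2_lipschitz_sub_le (T.elem K).isBounded_region hL hf _ _).trans ?_
    refine mul_le_mul_of_nonneg_left ?_ hL
    refine ((T.elem K).norm_projL2_sub_le k _ _).trans (le_of_eq ?_)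
    rw [← map_sub]
    rfl
  refine ⟨fun u => ∑ K, innerₗ (L2 (T.elem K).region) (g K u) ∘ₗ T.res K ∘ₗ
    (V.global bc).subtype, fun u v => ?_, fun u w v => ?_⟩
  · rw [LinearMap.sum_apply]
    refine Finset.sum_congr rfl fun K _ => ?_
    rw [locF, SimplePolygon.formM_eq_inner]
    rfl
  · rw [LinearMap.sum_apply, LinearMap.sum_apply, ← Finset.sum_sub_distrib]
    calc |∑ K, (⟪g K u, T.res K (v : L2 Ω)⟫ - ⟪g K w, T.res K (v : L2 Ω)⟫)|
        ≤ ∑ K, |⟪g K u, T.res K (v : L2 Ω)⟫ - ⟪g K w, T.res K (v : L2 Ω)⟫| :=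
          Finset.abs_sum_le_sum_abs _ _
      _ ≤ ∑ K, L * (‖T.res K (u - w : V.global bc)‖ * ‖T.res K (v : L2 Ω)‖) := by
          refine Finset.sum_le_sum fun K _ => ?_
          rw [← inner_sub_left, ← mul_assoc]
          exact (abs_real_inner_le_norm _ _).trans
            (mul_le_mul_of_nonneg_right (hg K u w) (norm_nonneg _))
      _ ≤ L * (‖(u - w : V.global bc)‖ * ‖v‖) := by
          rw [← Finset.mul_sum]
          exact mul_le_mul_of_nonneg_left (T.sum_norm_mul_le _ _) hL
      _ = _ := by ring

/-- Moving the previous value to the right adds a functional independent of `u`, which leaves the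
Lipschitz constant unchanged; the condition `dt * L < Clow` says that it is below the coercivity
constant `dt⁻¹ * Clow`. -/
theorem existsUnique_isEulerStep (hk : 1 ≤ k) {α₁ α₂ : ℝ} (hα₁ : 0 ≤ α₁) (hα₂ : 0 ≤ α₂)
    {f : ℝ → ℝ} {L : ℝ} (hL : 0 ≤ L) (hf : ∀ x y, |f x - f y| ≤ L * |x - y|) {Clow Cup : ℝ}
    (hC : V.MassConstants bc Clow Cup) {dt : ℝ} (hdt : 0 < dt) (hdtL : dt * L < Clow)
    (w : V.global bc) : ∃! u, V.IsEulerStep bc α₁ α₂ f dt w u := by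
  have := V.finiteDimensional_global bc
  obtain ⟨A, hA, hA0⟩ := V.exists_formA_eq bc hk
  obtain ⟨B, hB, hB0⟩ := V.exists_formB_eq bc
  obtain ⟨M, hM, -⟩ := V.exists_formM_eq bc
  obtain ⟨F, hF, hFL⟩ := V.exists_formF_eq bc hL hf
  have hLc : L < dt⁻¹ * Clow := by
    rw [inv_mul_eq_div, lt_div_iff₀ hdt]
    linarith
  obtain ⟨u, hu, huniq⟩ := existsUnique_semilinear (dt⁻¹ • M + α₁ • A + α₂ • B)
    (fun u => F u + dt⁻¹ • M w) hL hLc (fun v => by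
      have h1 := mul_le_mul_of_nonneg_left (hC.2.2.2 v) (inv_pos.2 hdt).le
      have h2 := mul_nonneg hα₁ (hA0 v)
      have h3 := mul_nonneg hα₂ (hB0 v)
      rw [hM] at h1
      simp only [LinearMap.add_apply, LinearMap.smul_apply, smul_eq_mul]
      linarith) (fun u z v => by simpa using hFL u z v)
  have hiff : ∀ u, V.IsEulerStep bc α₁ α₂ f dt w u ↔
      ∀ v, (dt⁻¹ • M + α₁ • A + α₂ • B) u v = (F u + dt⁻¹ • M w) v := by
    intro u
    refine forall_congr' fun v => ?_
    rw [hM, hA, hB, hF]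
    simp only [map_smul, map_sub, LinearMap.add_apply, LinearMap.sub_apply, LinearMap.smul_apply,
      smul_eq_mul]
    constructor <;> intro h <;> linarith
  exact ⟨u, (hiff u).2 hu, fun y hy => huniq y ((hiff y).1 hy)⟩

end VEM

end NCVEM

end

theorem mainTheorem6
    {Ω : Set NCVEM.Plane} (hΩ : NCVEM.IsPolygonalDomain Ω)
    (T : NCVEM.PolyMesh Ω) (bc : NCVEM.BC) (k : ℕ) (hk : 2 ≤ k) (V : NCVEM.VEM T k)
    (α₁ α₂ : ℝ) (hα₁ : 0 < α₁) (hα₂ : 0 < α₂)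
    (f : ℝ → ℝ) (Lf : ℝ) (hLf : 0 < Lf) (hf : ∀ x y, |f x - f y| ≤ Lf * |x - y|) :
    (∃ Clow Cup : ℝ, V.MassConstants bc Clow Cup) ∧
    ∀ Clow Cup : ℝ, V.MassConstants bc Clow Cup →
      ∀ (tfin : ℝ) (N : ℕ) (dt : ℝ), 0 < tfin → 0 < N → dt = tfin / N →
        dt < (2 * Lf)⁻¹ * min (max Clow (Cup ^ 2 * Clow⁻¹)) Clow →
        ∀ (n : ℕ) (hn : 1 ≤ n), n ≤ N → ∀ u : Fin n → V.global bc,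
          ∃! U : V.global bc,
            V.IsEulerStep bc α₁ α₂ f dt (u ⟨n - 1, Nat.sub_lt hn Nat.one_pos⟩) U := by
  refine ⟨V.exists_massConstants bc, ?_⟩
  intro Clow Cup hC tfin N dt htfin hN hdt hlt n hn _ u
  have hdt0 : 0 < dt := by
    rw [hdt]
    have : (0 : ℝ) < N := by exact_mod_cast hN
    positivity
  -- The minimum in the hypothesis is `Clow`, since the maximum dominates it; the bound `min ≤ Clow`
  -- suffices. The factor `2` is a spare margin.
  have hdtL : dt * Lf < Clow := by
    have h1 : dt < (2 * Lf)⁻¹ * Clow :=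
      hlt.trans_le (mul_le_mul_of_nonneg_left (min_le_right _ _) (by positivity))
    rw [inv_mul_eq_div, lt_div_iff₀ (by positivity)] at h1
    nlinarith [mul_pos hdt0 hLf]
  exact V.existsUnique_isEulerStep bc (by omega) hα₁.le hα₂.le hLf.le hf hC hdt0 hdtL _
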